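/- For $z\in\mathbb C$ let $$\Phi(z)=\frac12+\frac1{\sqrt{2\pi}}\int_0^z e^{-w^2/2}\,dw ,$$ the analytic continuation of the standard normal distribution function (the integral is taken along any contour from $0$ to $z$). Let $d\ge 0$ be an integer, let $\lambda_0,\lambda_1,\dots,\lambda_d$ be real numbers satisfying the hypotheses of (i) or (ii) below, and let $\varepsilon_1,\dots,\varepsilon_d\in\{\pm1\}$. For $d\ge1$ the matrix $\left(\frac1{\lambda_0}+\frac{\delta_{ij}}{\lambda_i}\right)_{i,j=1}^d$ is then positive definite; put $$g_d(\lambda_0;\lambda_1,\dots,\lambda_d;\varepsilon_1,\dots,\varepsilon_d)=\mathbb P\left[\varepsilon_1\eta_1\le 0,\dots,\varepsilon_d\eta_d\le 0\right],$$ where $(\eta_1,\dots,\eta_d)$ is a Gaussian random vector with mean $0$ and this covariance matrix, and $g_0(\lambda_0)=1$. Empty products are $1$ and empty sums are $0$. Then the following holds, all integrals being absolutely convergent. (i) Let $d\ge0$ and $\lambda_1,\dots,\lambda_d>0$, and suppose that either $\lambda_0>0$ or $\lambda_0<-(\lambda_1+\dots+\lambda_d)$. Then, for all $\varepsilon_1,\dots,\varepsilon_d\in\{\pm1\}$,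 $$g_d(\lambda_0;\lambda_1,\dots,\lambda_d;\varepsilon_1,\dots,\varepsilon_d)=\frac1{\sqrt{2\pi}}\int_{-\infty}^\infty\prod_{j=1}^d\Phi\left(\varepsilon_j\sqrt{\frac{\lambda_j}{\lambda_0}}\,x\right)e^{-x^2/2}\,dx,$$ where $\sqrt{\lambda_j/\lambda_0}=\sqrt{\lambda_j}/\sqrt{\lambda_0}$, with the convention $\sqrt{\lambda_0}=i\sqrt{-\lambda_0}$ for $\lambda_0<0$. (ii) Let $d\ge1$ and $k\in\{1,\dots,d\}$. Suppose that $\lambda_i>0$ for all $i\in\{0,\dots,d\}\setminus\{k\}$, $\lambda_k<0$ and $\lambda_0+\lambda_1+\dots+\lambda_d<0$. Then, for all $\varepsilon_1,\dots,\varepsilon_d\in\{\pm1\}$, $$g_d(\lambda_0;\lambda_1,\dots,\lambda_d;\varepsilon_1,\dots,\varepsilon_d)=\sqrt{\frac{\lambda_0}{2\pi}}\left(\int_0^\infty e^{-\lambda_0y^2/2}\prod_{\substack{j=1\\ j\ne k}}^d\Phi\left(\varepsilon_k\varepsilon_j\sqrt{\lambda_j}\,y\right)dy+2\int_0^\infty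 e^{\lambda_0y^2/2}\,\Phi\left(-\sqrt{-\lambda_k}\,y\right)\operatorname{Im}\left(\prod_{\substack{j=1\\ j\ne k}}^d\Phi\left(i\varepsilon_k\varepsilon_j\sqrt{\lambda_j}\,y\right)\right)dy\right).$$ -/

import Mathlib

open MeasureTheory ProbabilityTheory

/-- The covariance matrix `(1 / l₀ + δᵢⱼ / lᵢ)`, for `i, j ∈ {1, …, d}`. -/
noncomputable def orthantCov {d : ℕ} (l₀ : ℝ) (l : Fin d → ℝ) : Matrix (Fin d) (Fin d) ℝ :=
  Matrix.of fun i j => 1 / l₀ + if i = j then 1 / l i else 0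

/-- The orthant probability `g_d(l₀; l₁, …, l_d; e₁, …, e_d) = P[e₁ η₁ ≤ 0, …, e_d η_d ≤ 0]`, where
`η` is a centred Gaussian vector with covariance matrix `orthantCov l₀ l`. It is the genuine object
whenever that matrix is positive semidefinite. For `d = 0` the event is the whole one-point
space, so that `g_0(l₀) = 1` for every real `l₀`. -/
noncomputable def orthantProb {d : ℕ} (l₀ : ℝ) (l e : Fin d → ℝ) : ℝ :=
  (multivariateGaussian (0 : EuclideanSpace ℝ (Fin d)) (orthantCov l₀ l)).real
    {η | ∀ j, e j * η j ≤ 0}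

/-- The analytic continuation of the standard normal distribution function,
`Φ(z) = 1/2 + (2π)^(-1/2) ∫_0^z exp (-w² / 2) dw`; the integrand is entire, so the contour from
`0` to `z` does not matter, and the line segment `t ↦ t z`, `0 ≤ t ≤ 1`, is taken. -/
noncomputable def complexPhi (z : ℂ) : ℂ :=
  1 / 2 + 1 / (Real.sqrt (2 * Real.pi) : ℂ) *
    ∫ t in (0 : ℝ)..1, Complex.exp (-((t : ℂ) * z) ^ 2 / 2) * z

/-- The square root of a real number as a complex number, with the convention
`√x = i √(-x)` for `x < 0`. -/
noncomputable def complexSqrt (x : ℝ) : ℂ :=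
  if 0 ≤ x then (Real.sqrt x : ℂ) else Complex.I * (Real.sqrt (-x) : ℂ)

/-! ### Density of a nondegenerate Gaussian vector -/

section GaussianDensity

variable {ι : Type*} [Fintype ι]

/-! The covariance matrix is diagonal plus rank one, so its inverse is too, and the density is a
constant times `exp (-(∑ lⱼ xⱼ² - (∑ lⱼ xⱼ)² / (l₀ + ∑ lⱼ)) / 2)`. The cross term is decoupled by a
Gaussian integral: as a function of `z`, the product `exp (-l₀ z² / 2) ∏ exp (-lⱼ (xⱼ + z)² / 2)`
has leading exponent `-(l₀ + ∑ lⱼ) z² / 2`, and completing the square along a line on which this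
decays returns the density. Integrating over `x` first instead, each half-line integral is a
multiple of `Φ (eⱼ √lⱼ z)` (`complexPhi_mul_sqrt`). Fubini equates the two orders; the bound `|Φ z|
≤ exp ((Im z)² / 2)` (`norm_complexPhi_le`) supplies absolute convergence.

For (i) the line is real if `l₀ > 0` and imaginary if `l₀ < -∑ lⱼ` (`orthantProb_eq_integral_line`).

For (ii) the `k`-th factor `exp (-lₖ (xₖ + z)² / 2)` grows in real directions, since `lₖ < 0`. Write
`t = xₖ` and integrate along `z = -t + i v`, where this factor is `exp (-M v² / 2)` with `M = -lₖ`.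
After a sign normalisation `t` runs over `(-∞, 0]`, so these vertical lines sweep the right
half-plane, and the probability is a half-plane integral of `G(z) exp (-M (Im z)² / 2)`, with `G`
the entire function `gaussianPhiProd` (`orthantProb_eq_integral_halfPlane`). By Cauchy's theorem the
integral of `G` over a horizontal ray equals that over the positive axis minus `i ∫_0^v G(iy) dy`.
Pairing `v` with `-v` and using `G(conj z) = conj G(z)` leaves only `Im G(iy)`; exchanging `v` and
`y` turns the Gaussian weight into the tail `Φ (-√M y)` (`integral_halfPlane_eq`). -/

theorem pi_gaussianReal_eq_withDensity :
    Measure.pi (fun _ : ι => gaussianReal 0 1) =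
      (volume : Measure (ι → ℝ)).withDensity
        (fun x => ENNReal.ofReal (∏ i, gaussianPDFReal 0 1 (x i))) := by
  refine Measure.pi_eq fun s hs => ?_
  rw [withDensity_apply _ (MeasurableSet.univ_pi hs), volume_pi, Measure.restrict_pi_pi,
    ← ofReal_integral_eq_lintegral_ofReal, integral_fintype_prod_eq_prod,
    ENNReal.ofReal_prod_of_nonneg]
  · exact Finset.prod_congr rfl fun i _ =>
      (gaussianReal_apply_eq_integral 0 one_ne_zero (s i)).symm
  · exact fun i _ => integral_nonneg fun x => gaussianPDFReal_nonneg 0 1 x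
  · exact Integrable.fintype_prod fun i => (integrable_gaussianPDFReal 0 1).integrableOn
  · exact Filter.Eventually.of_forall fun x =>
      Finset.prod_nonneg fun i _ => gaussianPDFReal_nonneg 0 1 (x i)

theorem prod_gaussianPDFReal (x : ι → ℝ) :
    ∏ i, gaussianPDFReal 0 1 (x i) =
      (Real.sqrt (2 * Real.pi) ^ Fintype.card ι)⁻¹ * Real.exp (-(x ⬝ᵥ x) / 2) := by
  simp only [gaussianPDFReal, NNReal.coe_one, mul_one, sub_zero, Finset.prod_mul_distrib,
    Finset.prod_const, ← Real.exp_sum, Finset.card_univ, inv_pow, dotProduct, ← sq]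
  rw [← Finset.sum_div, Finset.sum_neg_distrib]

variable [DecidableEq ι]

open scoped MatrixOrder in
/-- The density of a nondegenerate centred Gaussian vector, `P` being the inverse of its
covariance matrix. -/
theorem multivariateGaussian_real_eq_integral {S P : Matrix ι ι ℝ} (hS : S.PosDef)
    (hP : P * S = 1) {A : Set (ι → ℝ)} (hA : MeasurableSet A) :
    (multivariateGaussian (0 : EuclideanSpace ℝ ι) S).real {x | WithLp.ofLp x ∈ A} =
      (Real.sqrt S.det * Real.sqrt (2 * Real.pi) ^ Fintype.card ι)⁻¹ *
        ∫ x in A, Real.exp (-(x ⬝ᵥ P.mulVec x) / 2) := by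
  set B := CFC.sqrt S with hB
  have hBB : B * B = S := CFC.sqrt_mul_sqrt_self _ hS.posSemidef.nonneg
  have hBsymm : B.transpose = B := by
    have h : B.IsHermitian := (CFC.sqrt_nonneg S).isSelfAdjoint
    simpa [Matrix.IsHermitian, Matrix.conjTranspose_eq_transpose_of_trivial] using h
  have hdet : B.det * B.det = S.det := by rw [← Matrix.det_mul, hBB]
  have hdet0 : B.det ≠ 0 := by
    intro h
    have := hS.det_pos
    simp [← hdet, h] at this
  have habs : |B.det| = Real.sqrt S.det := by
    rw [← hdet, Real.sqrt_mul_self_eq_abs]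
  -- As `B` is symmetric with `B² = P⁻¹`, one has `B P B = 1`: the form of `P` pulls back along `B`
  -- to the standard one.
  have hquad (x : ι → ℝ) : B.mulVec x ⬝ᵥ P.mulVec (B.mulVec x) = x ⬝ᵥ x := by
    have hBu : IsUnit B := (Matrix.isUnit_iff_isUnit_det B).2 hdet0.isUnit
    have h1 : B * P * B = 1 := by
      have h2 : (B * P * B) * B = B := by
        rw [Matrix.mul_assoc, hBB, Matrix.mul_assoc, hP, Matrix.mul_one]
      exact hBu.mul_right_cancel (by rw [h2, Matrix.one_mul])
    rw [Matrix.mulVec_mulVec, ← hBsymm, Matrix.mulVec_transpose, ← Matrix.dotProduct_mulVec,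
      Matrix.mulVec_mulVec, hBsymm, ← Matrix.mul_assoc, h1, Matrix.one_mulVec]
  have hpre : (fun x : EuclideanSpace ℝ ι => 0 + Matrix.toEuclideanCLM (𝕜 := ℝ) B x) ⁻¹'
        {x | WithLp.ofLp x ∈ A} =
      {x | WithLp.ofLp x ∈ (Matrix.toLin' B) ⁻¹' A} := by
    ext x
    simp [Matrix.ofLp_toEuclideanCLM]
  have hmA : MeasurableSet {x : EuclideanSpace ℝ ι | WithLp.ofLp x ∈ A} :=
    (by fun_prop : Measurable (fun x : EuclideanSpace ℝ ι => WithLp.ofLp x)) hA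
  have hmB : Measurable (Matrix.toLin' B : (ι → ℝ) → ι → ℝ) :=
    (LinearMap.continuous_of_finiteDimensional _).measurable
  have hmBA : MeasurableSet ((Matrix.toLin' B) ⁻¹' A) := hmB hA
  have hmBA' : MeasurableSet {x : EuclideanSpace ℝ ι | WithLp.ofLp x ∈ (Matrix.toLin' B) ⁻¹' A} :=
    (by fun_prop : Measurable (fun x : EuclideanSpace ℝ ι => WithLp.ofLp x)) hmBA
  rw [measureReal_def, multivariateGaussian, Measure.map_apply (by fun_prop) hmA, hpre,
    ← map_pi_eq_stdGaussian, Measure.map_apply (by fun_prop) hmBA']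
  change ((Measure.pi fun _ => gaussianReal 0 1) ((Matrix.toLin' B) ⁻¹' A)).toReal = _
  rw [pi_gaussianReal_eq_withDensity, withDensity_apply _ hmBA]
  have hg : Measurable fun y : ι → ℝ => ENNReal.ofReal
      ((Real.sqrt (2 * Real.pi) ^ Fintype.card ι)⁻¹ * Real.exp (-(y ⬝ᵥ P.mulVec y) / 2)) := by
    refine Continuous.measurable ?_ |>.ennreal_ofReal
    have : Continuous fun y : ι → ℝ => P.mulVec y :=
      Continuous.matrix_mulVec continuous_const continuous_id
    have := continuous_id.dotProduct this
    simp only [id] at this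
    fun_prop
  have hcomp (x : ι → ℝ) : ENNReal.ofReal (∏ i, gaussianPDFReal 0 1 (x i)) =
      (fun y : ι → ℝ => ENNReal.ofReal ((Real.sqrt (2 * Real.pi) ^ Fintype.card ι)⁻¹ *
        Real.exp (-(y ⬝ᵥ P.mulVec y) / 2))) (Matrix.toLin' B x) := by
    simp only [prod_gaussianPDFReal, Matrix.toLin'_apply, hquad]
  simp_rw [hcomp]
  -- Linear change of variables; the Jacobian `|det B|⁻¹` is `(√(det S))⁻¹`.
  rw [← setLIntegral_map hA hg hmB, Real.map_matrix_volume_pi_eq_smul_volume_pi hdet0,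
    Measure.restrict_smul, lintegral_smul_measure, smul_eq_mul, ENNReal.toReal_mul,
    ENNReal.toReal_ofReal (abs_nonneg _), ← integral_eq_lintegral_of_nonneg_ae,
    integral_const_mul, abs_inv, habs, mul_inv, mul_assoc]
  · exact Filter.Eventually.of_forall fun x => by positivity
  · have : Continuous fun y : ι → ℝ => P.mulVec y :=
      Continuous.matrix_mulVec continuous_const continuous_id
    have := continuous_id.dotProduct this
    simp only [id] at this
    exact Continuous.aestronglyMeasurable (by fun_prop)

end GaussianDensity

/-! ### The entire function `Φ`: half-line representation and growth -/

section ComplexPhi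

open Complex Filter Topology

theorem norm_cexp_neg_sq_div_two (z : ℂ) :
    ‖cexp (-z ^ 2 / 2)‖ = Real.exp (-z.re ^ 2 / 2) * Real.exp (z.im ^ 2 / 2) := by
  rw [norm_exp, ← Real.exp_add]
  congr 1
  simp [sq]
  ring

/-- The entire integrand has a primitive `G`, and the segment integral evaluates to `G z - G 0`. -/
theorem hasDerivAt_complexPhi (z : ℂ) :
    HasDerivAt complexPhi (1 / (Real.sqrt (2 * Real.pi) : ℂ) * cexp (-z ^ 2 / 2)) z := by
  have hd : Differentiable ℂ fun w : ℂ => cexp (-w ^ 2 / 2) := by fun_prop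
  obtain ⟨G, hG⟩ := hd.isExactOn_univ
  have key : complexPhi = fun z =>
      1 / 2 + 1 / (Real.sqrt (2 * Real.pi) : ℂ) * (G z - G 0) := by
    funext z
    rw [complexPhi]
    congr 2
    have h (t : ℝ) : HasDerivAt (fun t : ℝ => G ((t : ℂ) * z))
        (cexp (-((t : ℂ) * z) ^ 2 / 2) * z) t := by
      have h1 : HasDerivAt (fun t : ℝ => (t : ℂ) * z) z t := by
        simpa using (hasDerivAt_id t).ofReal_comp.mul_const z
      exact (hG _ (Set.mem_univ _)).comp t h1
    rw [intervalIntegral.integral_eq_sub_of_hasDerivAt (fun t _ => h t)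
      (Continuous.intervalIntegrable (by fun_prop) _ _)]
    simp
  rw [key]
  exact (((hG z (Set.mem_univ z)).sub_const _).const_mul _).const_add _

theorem differentiable_complexPhi : Differentiable ℂ complexPhi :=
  fun z => (hasDerivAt_complexPhi z).differentiableAt

theorem complexPhi_zero : complexPhi 0 = 1 / 2 := by
  simp [complexPhi]

theorem integrable_cexp_neg_sq_div_two (z : ℂ) :
    Integrable fun x : ℝ => cexp (-((x : ℂ) + z) ^ 2 / 2) := by
  have h := integrable_cexp_quadratic' (b := (-(1 / 2) : ℂ)) (by norm_num) (-z) (-z ^ 2 / 2)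
  refine h.congr (Eventually.of_forall fun x => ?_)
  simp only
  congr 1
  ring

theorem hasDerivAt_complexPhi_ofReal_add (z : ℂ) (x : ℝ) :
    HasDerivAt (fun x : ℝ => complexPhi ((x : ℂ) + z))
      (1 / (Real.sqrt (2 * Real.pi) : ℂ) * cexp (-((x : ℂ) + z) ^ 2 / 2)) x := by
  have h1 : HasDerivAt (fun x : ℝ => (x : ℂ) + z) 1 x := by
    simpa using (hasDerivAt_id x).ofReal_comp.add_const z
  have h2 := (hasDerivAt_complexPhi ((x : ℂ) + z)).comp x h1
  rw [mul_one] at h2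
  exact h2

theorem tendsto_complexPhi_ofReal_atBot :
    Tendsto (fun x : ℝ => complexPhi x) atBot (𝓝 0) := by
  have hi := ((integrable_cexp_neg_sq_div_two 0).const_mul
    (1 / (Real.sqrt (2 * Real.pi) : ℂ)))
  have h1 := intervalIntegral_tendsto_integral_Iic 0 hi.integrableOn tendsto_id
  have h2 (x : ℝ) := intervalIntegral.integral_eq_sub_of_hasDerivAt
    (fun y (_ : y ∈ Set.uIcc x 0) => hasDerivAt_complexPhi_ofReal_add 0 y)
    hi.intervalIntegrable
  simp only [id] at h1
  simp only [h2] at h1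
  have h3 : ∫ x in Set.Iic (0 : ℝ), 1 / (Real.sqrt (2 * Real.pi) : ℂ) *
      cexp (-((x : ℂ) + 0) ^ 2 / 2) = 1 / 2 := by
    rw [integral_const_mul]
    have h4 (x : ℝ) : cexp (-((x : ℂ) + 0) ^ 2 / 2) =
        ((Real.exp (-(1 / 2) * x ^ 2) : ℝ) : ℂ) := by
      push_cast
      congr 1
      ring
    simp_rw [h4]
    rw [integral_complex_ofReal]
    have h5 := integral_comp_neg_Iic (0 : ℝ) fun x => Real.exp (-(1 / 2) * x ^ 2)
    simp only [neg_sq, neg_zero] at h5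
    have h6 : Real.pi / (1 / 2) = 2 * Real.pi := by ring
    rw [h5, integral_gaussian_Ioi, h6]
    have : (Real.sqrt (2 * Real.pi) : ℂ) ≠ 0 := by
      norm_cast
      positivity
    push_cast
    field_simp
  rw [h3] at h1
  simp only [ofReal_zero, add_zero, complexPhi_zero] at h1
  simpa using h1.const_sub (1 / 2 : ℂ)

theorem tendsto_complexPhi_ofReal_add_atBot (z : ℂ) :
    Tendsto (fun x : ℝ => complexPhi ((x : ℂ) + z)) atBot (𝓝 0) := by
  have hbound (x : ℝ) : ‖complexPhi ((x : ℂ) + z) - complexPhi x‖ ≤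
      1 / Real.sqrt (2 * Real.pi) *
        (Real.exp (-x ^ 2 / 4) * Real.exp ((z.re ^ 2 + z.im ^ 2) / 2)) * ‖z‖ := by
    have hseg : ∀ w ∈ segment ℝ (x : ℂ) ((x : ℂ) + z),
        ‖1 / (Real.sqrt (2 * Real.pi) : ℂ) * cexp (-w ^ 2 / 2)‖ ≤
        1 / Real.sqrt (2 * Real.pi) *
        (Real.exp (-x ^ 2 / 4) * Real.exp ((z.re ^ 2 + z.im ^ 2) / 2)) := by
      intro w hw
      rw [segment_eq_image'] at hw
      obtain ⟨t, ht, rfl⟩ := hw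
      rw [norm_mul, norm_cexp_neg_sq_div_two]
      have : ‖1 / (Real.sqrt (2 * Real.pi) : ℂ)‖ = 1 / Real.sqrt (2 * Real.pi) := by
        rw [norm_div, norm_one, norm_real, Real.norm_of_nonneg (Real.sqrt_nonneg _)]
      rw [this, ← Real.exp_add, ← Real.exp_add]
      have ht2 : t ^ 2 ≤ 1 := by nlinarith [ht.1, ht.2]
      refine mul_le_mul_of_nonneg_left (Real.exp_le_exp.2 ?_) (by positivity)
      simp only [add_sub_cancel_left, add_re, ofReal_re, smul_re, smul_eq_mul, add_im, ofReal_im,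
        smul_im, zero_add]
      -- With `r = z.re`: `(x + t r)² / 2 - x² / 4 + t² r² / 2 = (x + 2 t r)² / 4 ≥ 0`.
      nlinarith [sq_nonneg (x + 2 * t * z.re), mul_le_mul_of_nonneg_right ht2 (sq_nonneg z.re),
        mul_le_mul_of_nonneg_right ht2 (sq_nonneg z.im)]
    have := (convex_segment (x : ℂ) ((x : ℂ) + z)).norm_image_sub_le_of_norm_hasDerivWithin_le
      (fun w _ => (hasDerivAt_complexPhi w).hasDerivWithinAt) hseg
      (left_mem_segment ℝ _ _) (right_mem_segment ℝ _ _)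
    simpa using this
  have hlim : Tendsto (fun x : ℝ => 1 / Real.sqrt (2 * Real.pi) *
        (Real.exp (-x ^ 2 / 4) * Real.exp ((z.re ^ 2 + z.im ^ 2) / 2)) * ‖z‖) atBot (𝓝 0) := by
    have h1 : Tendsto (fun x : ℝ => Real.exp (-x ^ 2 / 4)) atBot (𝓝 0) := by
      refine Real.tendsto_exp_atBot.comp ?_
      have h2 : Tendsto (fun x : ℝ => x ^ 2 / 4) atBot atTop := by
        have : Tendsto (fun x : ℝ => x ^ 2) atBot atTop := by
          exact ((tendsto_pow_atTop (α := ℝ) two_ne_zero).comp tendsto_neg_atBot_atTop).congr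
            fun x => neg_sq x
        exact this.atTop_div_const (by norm_num)
      exact (tendsto_neg_atTop_atBot.comp h2).congr fun x => (neg_div _ _).symm
    simpa using ((h1.mul_const _).const_mul _).mul_const ‖z‖
  have h := squeeze_zero_norm hbound hlim
  simpa using h.add tendsto_complexPhi_ofReal_atBot

/-- The integrand is the derivative of `x ↦ Φ (x + z)` up to the constant, and `Φ (x + z) → 0` as `x
→ -∞`. This form feeds both Fubini and the growth bound. -/
theorem complexPhi_eq_integral_Iic (z : ℂ) :
    complexPhi z = 1 / (Real.sqrt (2 * Real.pi) : ℂ) *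
      ∫ x in Set.Iic (0 : ℝ), cexp (-((x : ℂ) + z) ^ 2 / 2) := by
  have h := integral_Iic_of_hasDerivAt_of_tendsto' (a := (0 : ℝ))
    (fun x _ => hasDerivAt_complexPhi_ofReal_add z x)
    ((integrable_cexp_neg_sq_div_two z).const_mul _).integrableOn
    (tendsto_complexPhi_ofReal_add_atBot z)
  rw [← integral_const_mul, h]
  simp

theorem integral_exp_neg_add_sq (a : ℝ) :
    ∫ x : ℝ, Real.exp (-(x + a) ^ 2 / 2) = Real.sqrt (2 * Real.pi) := by
  rw [integral_add_right_eq_self (fun x : ℝ => Real.exp (-x ^ 2 / 2))]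
  have h := integral_gaussian (1 / 2)
  have h6 : Real.pi / (1 / 2) = 2 * Real.pi := by ring
  rw [h6] at h
  rw [← h]
  congr 1
  ext x
  congr 1
  ring

/-- Moduli are taken in the half-line representation, and the real Gaussian is enlarged to the whole
line, where it integrates to `√(2π)`. -/
theorem norm_complexPhi_le (z : ℂ) : ‖complexPhi z‖ ≤ Real.exp (z.im ^ 2 / 2) := by
  rw [complexPhi_eq_integral_Iic, norm_mul, norm_div, norm_one, norm_real,
    Real.norm_of_nonneg (Real.sqrt_nonneg _)]
  have h0 : 0 < Real.sqrt (2 * Real.pi) := by positivity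
  have h1 : ‖∫ x in Set.Iic (0 : ℝ), cexp (-((x : ℂ) + z) ^ 2 / 2)‖ ≤
      Real.sqrt (2 * Real.pi) * Real.exp (z.im ^ 2 / 2) := by
    refine (norm_integral_le_integral_norm _).trans ?_
    refine (setIntegral_le_integral (integrable_cexp_neg_sq_div_two z).norm
      (Eventually.of_forall fun x => norm_nonneg _)).trans_eq ?_
    simp_rw [norm_cexp_neg_sq_div_two]
    simp only [add_re, ofReal_re, add_im, ofReal_im, zero_add]
    rw [integral_mul_const, integral_exp_neg_add_sq]
  calc 1 / Real.sqrt (2 * Real.pi) * ‖∫ x in Set.Iic (0 : ℝ), cexp (-((x : ℂ) + z) ^ 2 / 2)‖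
      ≤ 1 / Real.sqrt (2 * Real.pi) *
        (Real.sqrt (2 * Real.pi) * Real.exp (z.im ^ 2 / 2)) := by gcongr
    _ = Real.exp (z.im ^ 2 / 2) := by field_simp

theorem integral_halfLine_comp_mul {a s : ℝ} (ha : 0 < a) (hs : s = 1 ∨ s = -1) (f : ℝ → ℂ) :
    ∫ x in {x : ℝ | s * x ≤ 0}, f (s * a * x) = (a : ℂ)⁻¹ * ∫ x in Set.Iic (0 : ℝ), f x := by
  have hm : MeasurableSet {x : ℝ | s * x ≤ 0} := measurableSet_le (by fun_prop) (by fun_prop)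
  rw [← integral_indicator hm, ← integral_indicator measurableSet_Iic]
  have h := Measure.integral_comp_mul_left ((Set.Iic (0 : ℝ)).indicator f) (s * a)
  have habs : |(s * a)⁻¹| = a⁻¹ := by
    rcases hs with rfl | rfl <;> simp [abs_of_pos ha]
  rw [habs] at h
  convert h using 1
  · congr 1
    ext x
    have : s * x ≤ 0 ↔ s * a * x ≤ 0 := by
      rw [mul_right_comm]
      refine ⟨fun h => mul_nonpos_of_nonpos_of_nonneg h ha.le, fun h => ?_⟩
      by_contra! h'
      exact h.not_gt (mul_pos h' ha)
    simp only [Set.indicator, Set.mem_ofPred_eq, Set.mem_Iic, this]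
  · rw [real_smul]
    simp

theorem complexPhi_mul_sqrt {l s : ℝ} (hl : 0 < l) (hs : s = 1 ∨ s = -1) (z : ℂ) :
    ∫ x in {x : ℝ | s * x ≤ 0}, cexp (-(l * ((x : ℂ) + z) ^ 2) / 2) =
      (Real.sqrt (2 * Real.pi / l) : ℂ) * complexPhi ((s : ℂ) * (Real.sqrt l : ℂ) * z) := by
  have ha : 0 < Real.sqrt l := Real.sqrt_pos.2 hl
  have h := integral_halfLine_comp_mul ha hs
    (fun x => cexp (-((x : ℂ) + (s : ℂ) * (Real.sqrt l : ℂ) * z) ^ 2 / 2))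
  have hl2 : (Real.sqrt l : ℂ) ^ 2 = l := by
    norm_cast
    exact Real.sq_sqrt hl.le
  have hs2 : (s : ℂ) ^ 2 = 1 := by
    rcases hs with rfl | rfl <;> simp
  have h2 (x : ℝ) : cexp (-(((s * Real.sqrt l * x : ℝ) : ℂ) +
      (s : ℂ) * (Real.sqrt l : ℂ) * z) ^ 2 / 2) = cexp (-(l * ((x : ℂ) + z) ^ 2) / 2) := by
    congr 3
    push_cast
    rw [show (s : ℂ) * (Real.sqrt l : ℂ) * x + s * (Real.sqrt l : ℂ) * z =
      s * (Real.sqrt l : ℂ) * (x + z) by ring, mul_pow, mul_pow, hl2, hs2, one_mul]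
  simp only [h2] at h
  rw [h, complexPhi_eq_integral_Iic, Real.sqrt_div (by positivity)]
  have : (Real.sqrt (2 * Real.pi) : ℂ) ≠ 0 := by
    norm_cast
    positivity
  push_cast
  field_simp

end ComplexPhi

/-! ### Precision matrix, determinant and density of the orthant probability -/

section OrthantDensity

variable {d : ℕ}

/-- The half-line `{x | s x ≤ 0}` with Lebesgue measure. -/
noncomputable abbrev halfLineMeasure (s : ℝ) : Measure ℝ :=
  volume.restrict {x : ℝ | s * x ≤ 0}

theorem measurableSet_halfLine (s : ℝ) : MeasurableSet {x : ℝ | s * x ≤ 0} :=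
  measurableSet_le (by fun_prop) (by fun_prop)

theorem orthantCov_dotProduct_mulVec (l₀ : ℝ) (l x : Fin d → ℝ) :
    x ⬝ᵥ (orthantCov l₀ l).mulVec x = (∑ j, x j) ^ 2 / l₀ + ∑ j, x j ^ 2 / l j := by
  simp only [orthantCov, dotProduct, Matrix.mulVec, Matrix.of_apply, add_mul, ite_mul, zero_mul,
    Finset.sum_add_distrib, Finset.sum_ite_eq, Finset.mem_univ, if_true, mul_add]
  congr 1
  · rw [sq, Finset.sum_mul, Finset.sum_div]
    refine Finset.sum_congr rfl fun i _ => ?_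
    rw [← Finset.mul_sum]
    ring
  · exact Finset.sum_congr rfl fun i _ => by ring

theorem orthantCov_posDef_of_forall_pos {l₀ : ℝ} {l : Fin d → ℝ}
    (h : ∀ x : Fin d → ℝ, x ≠ 0 → 0 < (∑ j, x j) ^ 2 / l₀ + ∑ j, x j ^ 2 / l j) :
    (orthantCov l₀ l).PosDef := by
  refine Matrix.PosDef.of_dotProduct_mulVec_pos ?_ fun x hx => ?_
  · ext i j
    simp only [orthantCov, Matrix.conjTranspose_apply, Matrix.of_apply, star_trivial]
    congr 1
    by_cases hij : i = j
    · simp [hij]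
    · simp [hij, Ne.symm hij]
  · simpa [orthantCov_dotProduct_mulVec] using h x hx

/-- The inverse of `orthantCov l₀ l`. -/
noncomputable def orthantPrecision (l₀ : ℝ) (l : Fin d → ℝ) : Matrix (Fin d) (Fin d) ℝ :=
  Matrix.of fun i j => (if i = j then l i else 0) - l i * l j / (l₀ + ∑ k, l k)

/-- The Sherman–Morrison formula for a diagonal matrix plus a rank-one matrix. -/
theorem orthantPrecision_mul_orthantCov {l₀ : ℝ} {l : Fin d → ℝ} (h₀ : l₀ ≠ 0)
    (hl : ∀ j, l j ≠ 0) (hs : l₀ + ∑ j, l j ≠ 0) :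
    orthantPrecision l₀ l * orthantCov l₀ l = 1 := by
  ext i k
  -- Each term is split into Kronecker deltas in `j` and a multiple of `l j`, so that the sum over
  -- `j` collapses.
  have hterm (j : Fin d) : orthantPrecision l₀ l i j * orthantCov l₀ l j k =
      (if i = j then l i * (1 / l₀ + if i = k then 1 / l k else 0) else 0) -
        (l i / ((l₀ + ∑ k, l k) * l₀) * l j +
          if j = k then l i / (l₀ + ∑ k, l k) else 0) := by
    have hk := hl k
    simp only [orthantPrecision, orthantCov, Matrix.of_apply]
    by_cases hij : i = j
    · subst hij
      by_cases hik : i = k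
      · subst hik
        simp only [if_true]
        field_simp
      · simp only [hik, if_true, if_false]
        field_simp
        ring
    · by_cases hjk : j = k
      · subst hjk
        simp only [hij, if_true, if_false]
        field_simp
        ring
      · simp only [hij, hjk, if_false]
        field_simp
        ring
  rw [Matrix.mul_apply, Finset.sum_congr rfl fun j _ => hterm j, Finset.sum_sub_distrib,
    Finset.sum_add_distrib, ← Finset.mul_sum, Finset.sum_ite_eq, Finset.sum_ite_eq',
    Matrix.one_apply]
  simp only [Finset.mem_univ, if_true]
  have hk := hl k
  by_cases hik : i = k
  · subst hik
    simp only [if_true]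
    field_simp
    ring
  · simp only [hik, if_false]
    field_simp
    ring

theorem orthantPrecision_dotProduct_mulVec (l₀ : ℝ) (l x : Fin d → ℝ) :
    x ⬝ᵥ (orthantPrecision l₀ l).mulVec x =
      ∑ j, l j * x j ^ 2 - (∑ j, l j * x j) ^ 2 / (l₀ + ∑ j, l j) := by
  simp only [orthantPrecision, dotProduct, Matrix.mulVec, Matrix.of_apply, sub_mul, ite_mul,
    zero_mul, Finset.sum_sub_distrib, Finset.sum_ite_eq, Finset.mem_univ, if_true, mul_sub]
  congr 1
  · exact Finset.sum_congr rfl fun i _ => by ring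
  · rw [sq, Finset.sum_mul, Finset.sum_div]
    refine Finset.sum_congr rfl fun i _ => ?_
    rw [Finset.mul_sum, Finset.mul_sum, Finset.sum_div]
    exact Finset.sum_congr rfl fun j _ => by ring

/-- The matrix determinant lemma, after factoring out the diagonal part. -/
theorem det_orthantCov {l₀ : ℝ} {l : Fin d → ℝ} (h₀ : l₀ ≠ 0) (hl : ∀ j, l j ≠ 0) :
    (orthantCov l₀ l).det = (l₀ + ∑ j, l j) / (l₀ * ∏ j, l j) := by
  have h1 : orthantCov l₀ l = Matrix.diagonal (fun j => (l j)⁻¹) *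
      (1 + Matrix.replicateCol Unit l * Matrix.replicateRow Unit fun _ => l₀⁻¹) := by
    ext i j
    have hi := hl i
    rw [Matrix.diagonal_mul]
    simp only [orthantCov, Matrix.of_apply, Matrix.add_apply,
      Matrix.one_apply, Matrix.mul_apply, Matrix.replicateCol_apply, Matrix.replicateRow_apply,
      Finset.univ_unique, Finset.sum_singleton]
    split_ifs <;> field_simp
    · ring
    · ring
  rw [h1, Matrix.det_mul, Matrix.det_diagonal, Matrix.det_one_add_replicateCol_mul_replicateRow,
    Finset.prod_inv_distrib, dotProduct, ← Finset.mul_sum]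
  have hp : ∏ j, l j ≠ 0 := Finset.prod_ne_zero_iff.2 fun j _ => hl j
  field_simp

theorem orthantProb_eq_integral {l₀ : ℝ} {l : Fin d → ℝ} (hS : (orthantCov l₀ l).PosDef)
    (h₀ : l₀ ≠ 0) (hl : ∀ j, l j ≠ 0) (hs : l₀ + ∑ j, l j ≠ 0) (e : Fin d → ℝ) :
    orthantProb l₀ l e =
      (Real.sqrt ((l₀ + ∑ j, l j) / (l₀ * ∏ j, l j)) * Real.sqrt (2 * Real.pi) ^ d)⁻¹ *
        ∫ x, Real.exp (-(∑ j, l j * x j ^ 2 - (∑ j, l j * x j) ^ 2 / (l₀ + ∑ j, l j)) / 2)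
          ∂Measure.pi fun j => halfLineMeasure (e j) := by
  have hA : {x : Fin d → ℝ | ∀ j, e j * x j ≤ 0} =
      Set.univ.pi fun j => {x : ℝ | e j * x ≤ 0} := by
    ext x
    simp
  have hm : MeasurableSet {x : Fin d → ℝ | ∀ j, e j * x j ≤ 0} := by
    rw [hA]
    exact MeasurableSet.univ_pi fun j => measurableSet_halfLine _
  have h := multivariateGaussian_real_eq_integral hS
    (orthantPrecision_mul_orthantCov h₀ hl hs) hm
  simp only [orthantPrecision_dotProduct_mulVec, det_orthantCov h₀ hl, Fintype.card_fin] at h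
  rw [hA, volume_pi, Measure.restrict_pi_pi, ← hA] at h
  exact h

/-- The density is even, and `x ↦ -x` exchanges the two orthants. -/
theorem orthantProb_neg {l₀ : ℝ} {l : Fin d → ℝ} (hS : (orthantCov l₀ l).PosDef)
    (h₀ : l₀ ≠ 0) (hl : ∀ j, l j ≠ 0) (hs : l₀ + ∑ j, l j ≠ 0) (e : Fin d → ℝ) :
    orthantProb l₀ l (fun j => -e j) = orthantProb l₀ l e := by
  rw [orthantProb_eq_integral hS h₀ hl hs, orthantProb_eq_integral hS h₀ hl hs]
  congr 1
  simp_rw [halfLineMeasure]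
  rw [← Measure.restrict_pi_pi, ← Measure.restrict_pi_pi, ← volume_pi]
  have hm (e : Fin d → ℝ) : MeasurableSet (Set.univ.pi fun j => {x : ℝ | e j * x ≤ 0}) :=
    MeasurableSet.univ_pi fun j => measurableSet_halfLine _
  rw [← integral_indicator (hm _), ← integral_indicator (hm _), ← integral_neg_eq_self]
  congr 1
  ext x
  have : -x ∈ (Set.univ.pi fun j => {x : ℝ | -e j * x ≤ 0}) ↔
      x ∈ (Set.univ.pi fun j => {x : ℝ | e j * x ≤ 0}) := by simp
  simp only [Set.indicator, this]
  simp

end OrthantDensity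

/-! ### Fubini for products of shifted Gaussians -/

section ProductFubini

open Complex

variable {d : ℕ}

theorem norm_cexp_neg_mul_sq_div_two (l : ℝ) (z : ℂ) (x : ℝ) :
    ‖cexp (-(l * ((x : ℂ) + z) ^ 2) / 2)‖ =
      Real.exp (-(l / 2) * (x + z.re) ^ 2) * Real.exp (l * z.im ^ 2 / 2) := by
  rw [norm_exp, ← Real.exp_add]
  congr 1
  simp [sq]
  ring

theorem integrable_cexp_neg_mul_sq_div_two {l : ℝ} (hl : 0 < l) (z : ℂ) :
    Integrable fun x : ℝ => cexp (-(l * ((x : ℂ) + z) ^ 2) / 2) := by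
  have h := integrable_cexp_quadratic' (b := (-(l / 2) : ℂ)) (by simpa using hl)
    (-(l * z)) (-(l * z ^ 2) / 2)
  refine h.congr (Filter.Eventually.of_forall fun x => ?_)
  simp only
  congr 1
  ring

theorem integral_norm_cexp_le {l : ℝ} (hl : 0 < l) (z : ℂ) (s : ℝ) :
    ∫ x, ‖cexp (-(l * ((x : ℂ) + z) ^ 2) / 2)‖ ∂halfLineMeasure s ≤
      Real.sqrt (2 * Real.pi / l) * Real.exp (l * z.im ^ 2 / 2) := by
  refine (setIntegral_le_integral (integrable_cexp_neg_mul_sq_div_two hl z).norm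
      (Filter.Eventually.of_forall fun x => norm_nonneg _)).trans_eq ?_
  simp_rw [norm_cexp_neg_mul_sq_div_two]
  rw [integral_mul_const, integral_add_right_eq_self (fun x : ℝ => Real.exp (-(l / 2) * x ^ 2)),
    integral_gaussian]
  congr 2
  field_simp

variable {α : Type*} [MeasurableSpace α] {ν : Measure α} [SFinite ν] {l e : Fin d → ℝ}
  {Z W : α → ℂ}

theorem integral_mul_prod_cexp (hl : ∀ j, 0 < l j) (he : ∀ j, e j = 1 ∨ e j = -1) (w z : ℂ) :
    ∫ x, w * ∏ j, cexp (-(l j * ((x j : ℂ) + z) ^ 2) / 2)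
        ∂Measure.pi (fun j => halfLineMeasure (e j)) =
      (∏ j, (Real.sqrt (2 * Real.pi / l j) : ℂ)) *
        (w * ∏ j, complexPhi ((e j : ℂ) * (Real.sqrt (l j) : ℂ) * z)) := by
  rw [integral_const_mul, integral_fintype_prod_eq_prod (μ := fun j => halfLineMeasure (e j))
    (f := fun j (x : ℝ) => cexp (-(l j * ((x : ℂ) + z) ^ 2) / 2))]
  simp_rw [fun j => complexPhi_mul_sqrt (hl j) (he j) z]
  rw [Finset.prod_mul_distrib]
  ring

/-- For fixed `a` the `x`-integral of the modulus is at most a constant times `‖W a‖ exp (∑ lⱼ (Im Z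
a)² / 2)`, so only the auxiliary variable has to be controlled. The space `α` is a line in (i) and a
half-plane in (ii). -/
theorem integrable_mul_prod_cexp (hl : ∀ j, 0 < l j) (hZ : Measurable Z) (hW : Measurable W)
    (hi : Integrable (fun a => ‖W a‖ * Real.exp ((∑ j, l j) * (Z a).im ^ 2 / 2)) ν) :
    Integrable (fun p : (Fin d → ℝ) × α =>
        W p.2 * ∏ j, cexp (-(l j * ((p.1 j : ℂ) + Z p.2) ^ 2) / 2))
      ((Measure.pi fun j => halfLineMeasure (e j)).prod ν) := by
  have hm : Measurable (fun p : (Fin d → ℝ) × α =>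
      W p.2 * ∏ j, cexp (-(l j * ((p.1 j : ℂ) + Z p.2) ^ 2) / 2)) := by fun_prop
  rw [integrable_prod_iff' hm.aestronglyMeasurable]
  refine ⟨Filter.Eventually.of_forall fun a => ?_, ?_⟩
  · exact (Integrable.fintype_prod (μ := fun j => halfLineMeasure (e j))
      (f := fun j (x : ℝ) => cexp (-(l j * ((x : ℂ) + Z a) ^ 2) / 2)) fun j =>
      (integrable_cexp_neg_mul_sq_div_two (hl j) (Z a)).integrableOn).const_mul (W a)
  · refine (hi.const_mul (∏ j, Real.sqrt (2 * Real.pi / l j))).mono'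
      hm.aestronglyMeasurable.norm.prod_swap.integral_prod_right'
      (Filter.Eventually.of_forall fun a => ?_)
    simp only [norm_mul, norm_prod]
    rw [Real.norm_of_nonneg (integral_nonneg fun x => by positivity), integral_const_mul,
      integral_fintype_prod_eq_prod (μ := fun j => halfLineMeasure (e j))
        (f := fun j (x : ℝ) => ‖cexp (-(l j * ((x : ℂ) + Z a) ^ 2) / 2)‖)]
    calc ‖W a‖ * ∏ j, ∫ x, ‖cexp (-(l j * ((x : ℂ) + Z a) ^ 2) / 2)‖ ∂halfLineMeasure (e j)
        ≤ ‖W a‖ * ∏ j, (Real.sqrt (2 * Real.pi / l j) * Real.exp (l j * (Z a).im ^ 2 / 2)) := by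
          gcongr with j
          exact integral_norm_cexp_le (hl j) (Z a) (e j)
      _ = _ := by
          rw [Finset.prod_mul_distrib, ← Real.exp_sum, Finset.sum_mul, Finset.sum_div]
          ring

end ProductFubini

/-! ### Part (i): decoupling along a line -/

section LineFormula

open Complex

variable {d : ℕ}

theorem integral_cexp_quadratic_of_pos {b : ℝ} (hb : 0 < b) (c k : ℂ) :
    ∫ v : ℝ, cexp (-(b / 2) * (v : ℂ) ^ 2 + c * v + k) =
      (Real.sqrt (2 * Real.pi / b) : ℂ) * cexp (k + c ^ 2 / (2 * b)) := by
  rw [integral_cexp_quadratic (b := (-(b / 2) : ℂ)) (by simpa using hb)]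
  have hbc : (b : ℂ) ≠ 0 := by exact_mod_cast hb.ne'
  congr 1
  · have h1 : (Real.pi : ℂ) / -(-(b / 2)) = ((2 * Real.pi / b : ℝ) : ℂ) := by
      push_cast
      field_simp
    rw [h1, Real.sqrt_eq_rpow, ofReal_cpow (by positivity)]
    norm_num
  · congr 1
    field_simp
    ring

theorem prod_sqrt_two_pi_div {l : Fin d → ℝ} (hl : ∀ j, 0 < l j) :
    ∏ j, Real.sqrt (2 * Real.pi / l j) =
      Real.sqrt (2 * Real.pi) ^ d / Real.sqrt (∏ j, l j) := by
  have h (j : Fin d) : Real.sqrt (2 * Real.pi / l j) =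
      Real.sqrt (2 * Real.pi) / Real.sqrt (l j) := Real.sqrt_div (by positivity) _
  simp_rw [h]
  rw [Finset.prod_div_distrib, Real.sqrt_prod _ fun j _ => (hl j).le]
  simp

/-- Completing the square in `v` produces `σ² (∑ lⱼ xⱼ)² / (2b)`, in which `σ` cancels because `b =
σ² (l₀ + ∑ lⱼ)`. -/
theorem integral_cexp_mul_prod_cexp {l₀ b : ℝ} {l : Fin d → ℝ} {σ : ℂ} (hb : 0 < b)
    (hσb : σ ^ 2 * ((l₀ + ∑ j, l j : ℝ) : ℂ) = b) (x : Fin d → ℝ) :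
    ∫ v : ℝ, cexp (-(l₀ * (σ * v) ^ 2) / 2) *
        ∏ j, cexp (-(l j * ((x j : ℂ) + σ * v) ^ 2) / 2) =
      (Real.sqrt (2 * Real.pi / b) : ℂ) * (Real.exp
        (-(∑ j, l j * x j ^ 2 - (∑ j, l j * x j) ^ 2 / (l₀ + ∑ j, l j)) / 2) : ℝ) := by
  have hbc : (b : ℂ) ≠ 0 := by exact_mod_cast hb.ne'
  have hΛ : ((l₀ + ∑ j, l j : ℝ) : ℂ) ≠ 0 := by
    intro h
    rw [h, mul_zero] at hσb
    exact hbc hσb.symm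
  have hσ : σ ≠ 0 := by
    rintro rfl
    exact hbc (by rw [← hσb]; simp)
  have h (v : ℝ) : cexp (-(l₀ * (σ * v) ^ 2) / 2) *
      ∏ j, cexp (-(l j * ((x j : ℂ) + σ * v) ^ 2) / 2) =
      cexp (-(b / 2) * (v : ℂ) ^ 2 + (-(σ * ∑ j, (l j : ℂ) * x j)) * v +
        -(∑ j, (l j : ℂ) * x j ^ 2) / 2) := by
    rw [← exp_sum, ← exp_add, ← hσb]
    congr 1
    have h1 (j : Fin d) : -((l j : ℂ) * ((x j : ℂ) + σ * v) ^ 2) / 2 =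
        (l j * x j ^ 2) * (-1 / 2) + (l j * x j) * (-(σ * v)) + l j * (-(σ * v) ^ 2 / 2) := by
      ring
    simp_rw [h1]
    rw [Finset.sum_add_distrib, Finset.sum_add_distrib, ← Finset.sum_mul, ← Finset.sum_mul,
      ← Finset.sum_mul]
    push_cast
    ring
  simp_rw [h]
  rw [integral_cexp_quadratic_of_pos hb]
  congr 1
  push_cast at hΛ ⊢
  rw [← hσb]
  congr 1
  push_cast
  field_simp
  ring

/-- One double integral over `x` and `v`, evaluated in both orders along `z = σ v`. The rate `a`
belongs to `exp (-l₀ z² / 2)`, `b` to the full exponent in `v`, and `c` to the majorant left once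
the growth of the `Φ` factors is absorbed. -/
theorem orthantProb_eq_integral_line {l₀ a b c : ℝ} {l e : Fin d → ℝ} {σ : ℂ}
    (hS : (orthantCov l₀ l).PosDef) (hl : ∀ j, 0 < l j) (he : ∀ j, e j = 1 ∨ e j = -1)
    (ha : 0 < a) (hb : 0 < b) (hc : 0 < c) (hσa : σ ^ 2 * (l₀ : ℂ) = a)
    (hσb : σ ^ 2 * ((l₀ + ∑ j, l j : ℝ) : ℂ) = b) (hσc : a - (∑ j, l j) * σ.im ^ 2 = c) :
    Integrable (fun v : ℝ => cexp (-(a * (v : ℂ) ^ 2) / 2) *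
      ∏ j, complexPhi ((e j : ℂ) * (Real.sqrt (l j) : ℂ) * (σ * v))) ∧
    (orthantProb l₀ l e : ℂ) = (Real.sqrt (a / (2 * Real.pi)) : ℂ) *
      ∫ v : ℝ, cexp (-(a * (v : ℂ) ^ 2) / 2) *
        ∏ j, complexPhi ((e j : ℂ) * (Real.sqrt (l j) : ℂ) * (σ * v)) := by
  have hP : 0 < ∏ j, l j := Finset.prod_pos fun j _ => hl j
  have hweight (v : ℝ) : ‖cexp (-(l₀ * (σ * v) ^ 2) / 2)‖ *
      Real.exp ((∑ j, l j) * (σ * v).im ^ 2 / 2) = Real.exp (-(c / 2) * v ^ 2) := by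
    have h1 : -((l₀ : ℂ) * (σ * v) ^ 2) / 2 = ((-(a * v ^ 2) / 2 : ℝ) : ℂ) := by
      push_cast
      rw [← hσa]
      ring
    rw [h1, ← ofReal_exp, norm_real, Real.norm_of_nonneg (Real.exp_pos _).le, ← Real.exp_add,
      ← hσc, im_mul_ofReal]
    congr 1
    ring
  have hi := integrable_mul_prod_cexp (e := e) (ν := volume) (Z := fun v : ℝ => σ * v)
    (W := fun v : ℝ => cexp (-(l₀ * (σ * v) ^ 2) / 2)) hl (by fun_prop) (by fun_prop)
    ((integrable_exp_neg_mul_sq (half_pos hc)).congr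
      (Filter.Eventually.of_forall fun v => (hweight v).symm))
  have hs := integral_prod_symm _ hi
  rw [integral_prod _ hi] at hs
  have hex (v : ℝ) : cexp (-(l₀ * (σ * v) ^ 2) / 2) = cexp (-(a * (v : ℂ) ^ 2) / 2) := by
    rw [← hσa]
    congr 1
    ring
  have hr := hi.integral_prod_right
  simp only [integral_mul_prod_cexp hl he, integral_cexp_mul_prod_cexp hb hσb] at hs hr
  simp only [hex] at hs hr
  have hsa := Real.sqrt_pos.2 ha
  have hsb := Real.sqrt_pos.2 hb
  have hsP := Real.sqrt_pos.2 hP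
  have hpi : 0 < Real.sqrt (2 * Real.pi) := by positivity
  have hprod : (∏ j, (Real.sqrt (2 * Real.pi / l j) : ℂ)) ≠ 0 :=
    Finset.prod_ne_zero_iff.2 fun j _ => by
      have := Real.sqrt_pos.2 (div_pos (mul_pos two_pos Real.pi_pos) (hl j))
      exact_mod_cast this.ne'
  refine ⟨?_, ?_⟩
  · exact (integrable_const_mul_iff hprod.isUnit _).1 hr
  · have h0 : l₀ ≠ 0 := by
      rintro rfl
      simp at hσa
      exact ha.ne (by exact_mod_cast hσa)
    have hΛ : l₀ + ∑ j, l j ≠ 0 := by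
      intro h
      rw [h] at hσb
      simp at hσb
      exact hb.ne (by exact_mod_cast hσb)
    have hratio : (l₀ + ∑ j, l j) / (l₀ * ∏ j, l j) = b / (a * ∏ j, l j) := by
      have : (l₀ + ∑ j, l j) * a = b * l₀ := by
        have : ((l₀ + ∑ j, l j : ℝ) : ℂ) * a = b * l₀ := by
          rw [← hσa, ← hσb]
          ring
        exact_mod_cast this
      field_simp
      linear_combination this
    rw [integral_const_mul, integral_const_mul, integral_complex_ofReal] at hs
    rw [orthantProb_eq_integral hS h0 (fun j => (hl j).ne') hΛ, hratio]
    push_cast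
    set I1 := ∫ v : ℝ, cexp (-(a * (v : ℂ) ^ 2) / 2) *
        ∏ j, complexPhi ((e j : ℂ) * (Real.sqrt (l j) : ℂ) * (σ * v))
    set J := ∫ x, Real.exp (-(∑ j, l j * x j ^ 2 - (∑ j, l j * x j) ^ 2 / (l₀ + ∑ j, l j)) / 2)
      ∂Measure.pi fun j => halfLineMeasure (e j)
    clear_value J I1
    rw [← ofReal_prod, prod_sqrt_two_pi_div hl, Real.sqrt_div (by positivity)] at hs
    rw [Real.sqrt_div hb.le, Real.sqrt_mul ha.le, Real.sqrt_div ha.le]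
    have e1 : (Real.sqrt a : ℂ) ≠ 0 := by exact_mod_cast hsa.ne'
    have e2 : (Real.sqrt b : ℂ) ≠ 0 := by exact_mod_cast hsb.ne'
    have e3 : (Real.sqrt (∏ j, l j) : ℂ) ≠ 0 := by exact_mod_cast hsP.ne'
    have e4 : (Real.sqrt (2 * Real.pi) : ℂ) ≠ 0 := by exact_mod_cast hpi.ne'
    push_cast at hs ⊢
    field_simp at hs ⊢
    linear_combination hs

theorem orthantCov_posDef_of_pos {l₀ : ℝ} {l : Fin d → ℝ} (h₀ : 0 < l₀) (hl : ∀ j, 0 < l j) :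
    (orthantCov l₀ l).PosDef := by
  refine orthantCov_posDef_of_forall_pos fun x hx => ?_
  obtain ⟨i, hi⟩ := Function.ne_iff.1 hx
  have h1 : 0 < ∑ j, x j ^ 2 / l j :=
    Finset.sum_pos' (fun j _ => div_nonneg (sq_nonneg _) (hl j).le)
      ⟨i, Finset.mem_univ i, div_pos (by simpa [sq_pos_iff] using hi) (hl i)⟩
  positivity

theorem sum_sq_le_mul_sum_sq_div {ι : Type*} (s : Finset ι) {l : ι → ℝ} (hl : ∀ j ∈ s, 0 < l j)
    (x : ι → ℝ) : (∑ j ∈ s, x j) ^ 2 ≤ (∑ j ∈ s, l j) * ∑ j ∈ s, x j ^ 2 / l j :=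
  Finset.sum_sq_le_sum_mul_sum_of_sq_le_mul s (fun j hj => (hl j hj).le)
    (fun j hj => div_nonneg (sq_nonneg _) (hl j hj).le)
    fun j hj => by
      have := (hl j hj).ne'
      exact le_of_eq (by field_simp)

/-- Cauchy–Schwarz gives `(∑ xⱼ)² ≤ (∑ lⱼ) ∑ xⱼ² / lⱼ`, and `∑ lⱼ < -l₀`. -/
theorem orthantCov_posDef_of_neg {l₀ : ℝ} {l : Fin d → ℝ} (hl : ∀ j, 0 < l j)
    (h : l₀ < -∑ j, l j) : (orthantCov l₀ l).PosDef := by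
  refine orthantCov_posDef_of_forall_pos fun x hx => ?_
  obtain ⟨i, hi⟩ := Function.ne_iff.1 hx
  have h1 : 0 < ∑ j, x j ^ 2 / l j :=
    Finset.sum_pos' (fun j _ => div_nonneg (sq_nonneg _) (hl j).le)
      ⟨i, Finset.mem_univ i, div_pos (by simpa [sq_pos_iff] using hi) (hl i)⟩
  have h2 := sum_sq_le_mul_sum_sq_div Finset.univ (fun j _ => hl j) x
  have h3 : 0 ≤ ∑ j, l j := Finset.sum_nonneg fun j _ => (hl j).le
  have h4 : l₀ < 0 := by linarith
  have h5 : (∑ j, x j) ^ 2 < (-l₀) * ∑ j, x j ^ 2 / l j :=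
    h2.trans_lt (mul_lt_mul_of_pos_right (by linarith) h1)
  have h6 : (∑ j, x j) ^ 2 / (-l₀) < ∑ j, x j ^ 2 / l j := by
    rw [div_lt_iff₀ (by linarith)]
    linarith
  rw [div_neg] at h6
  linarith

/-- Substitution `v = x / √a`; the condition `hσ` ties the direction `σ` to the chosen branch of
`√l₀`. -/
theorem integrable_and_orthantProb_eq_of_scaling {l₀ a : ℝ} {l e : Fin d → ℝ} {σ : ℂ}
    (ha : 0 < a) (hl : ∀ j, 0 < l j)
    (hσ : complexSqrt l₀ * σ = (Real.sqrt a : ℂ))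
    (h : Integrable (fun v : ℝ => cexp (-(a * (v : ℂ) ^ 2) / 2) *
      ∏ j, complexPhi ((e j : ℂ) * (Real.sqrt (l j) : ℂ) * (σ * v))) ∧
    (orthantProb l₀ l e : ℂ) = (Real.sqrt (a / (2 * Real.pi)) : ℂ) *
      ∫ v : ℝ, cexp (-(a * (v : ℂ) ^ 2) / 2) *
        ∏ j, complexPhi ((e j : ℂ) * (Real.sqrt (l j) : ℂ) * (σ * v))) :
    Integrable (fun x : ℝ =>
        (∏ j, complexPhi ((e j : ℂ) * (complexSqrt (l j) / complexSqrt l₀) * (x : ℂ))) *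
          cexp (-(x : ℂ) ^ 2 / 2)) ∧
      (orthantProb l₀ l e : ℂ) =
        1 / (Real.sqrt (2 * Real.pi) : ℂ) *
          ∫ x : ℝ,
            (∏ j, complexPhi ((e j : ℂ) * (complexSqrt (l j) / complexSqrt l₀) * (x : ℂ))) *
              cexp (-(x : ℂ) ^ 2 / 2) := by
  have hsa := Real.sqrt_pos.2 ha
  have hsac : (Real.sqrt a : ℂ) ≠ 0 := by exact_mod_cast hsa.ne'
  have hc0 : complexSqrt l₀ ≠ 0 := left_ne_zero_of_mul (hσ ▸ hsac)
  have ha2 : (Real.sqrt a : ℂ) ^ 2 = a := by exact_mod_cast Real.sq_sqrt ha.le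
  set g : ℝ → ℂ := fun v => cexp (-(a * (v : ℂ) ^ 2) / 2) *
    ∏ j, complexPhi ((e j : ℂ) * (Real.sqrt (l j) : ℂ) * (σ * v)) with hg
  have hx (x : ℝ) : (∏ j, complexPhi ((e j : ℂ) * (complexSqrt (l j) / complexSqrt l₀) * (x : ℂ))) *
      cexp (-(x : ℂ) ^ 2 / 2) = g (x / Real.sqrt a) := by
    simp only [hg]
    rw [mul_comm]
    congr 2
    · push_cast
      rw [div_pow, ha2]
      have : (a : ℂ) ≠ 0 := by exact_mod_cast ha.ne'
      field_simp
    · ext j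
      congr 1
      rw [complexSqrt, if_pos (hl j).le]
      push_cast
      field_simp
      rw [← hσ]
      ring
  simp_rw [hx]
  refine ⟨h.1.comp_div hsa.ne', ?_⟩
  rw [Measure.integral_comp_div g, h.2, abs_of_pos hsa, real_smul, Real.sqrt_div ha.le]
  push_cast
  ring

theorem integrable_and_orthantProb_eq_integral_prod_complexPhi {l₀ : ℝ} {l e : Fin d → ℝ}
    (hl : ∀ j, 0 < l j) (h₀ : 0 < l₀ ∨ l₀ < -∑ j, l j) (he : ∀ j, e j = 1 ∨ e j = -1) :
    Integrable (fun x : ℝ =>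
        (∏ j, complexPhi ((e j : ℂ) * (complexSqrt (l j) / complexSqrt l₀) * (x : ℂ))) *
          cexp (-(x : ℂ) ^ 2 / 2)) ∧
      (orthantProb l₀ l e : ℂ) =
        1 / (Real.sqrt (2 * Real.pi) : ℂ) *
          ∫ x : ℝ,
            (∏ j, complexPhi ((e j : ℂ) * (complexSqrt (l j) / complexSqrt l₀) * (x : ℂ))) *
              cexp (-(x : ℂ) ^ 2 / 2) := by
  have h3 : 0 ≤ ∑ j, l j := Finset.sum_nonneg fun j _ => (hl j).le
  rcases h₀ with h₀ | h₀
  · refine integrable_and_orthantProb_eq_of_scaling h₀ hl (σ := 1) ?_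
      (orthantProb_eq_integral_line (b := l₀ + ∑ j, l j) (c := l₀)
        (orthantCov_posDef_of_pos h₀ hl) hl he h₀ (by positivity) h₀ (by simp) (by simp) (by simp))
    simp [complexSqrt, h₀.le]
  -- The direction `-I` rather than `I` makes `i √(-l₀) · σ` equal to `√(-l₀)`.
  · refine integrable_and_orthantProb_eq_of_scaling (a := -l₀) (by linarith) hl (σ := -I) ?_
      (orthantProb_eq_integral_line (b := -(l₀ + ∑ j, l j)) (c := -(l₀ + ∑ j, l j))
        (orthantCov_posDef_of_neg hl h₀) hl he (by linarith) (by linarith) (by linarith)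
        (by simp) (by simp) (by simp; ring))
    rw [complexSqrt, if_neg (by linarith)]
    linear_combination (-(Real.sqrt (-l₀) : ℂ)) * I_sq

end LineFormula

/-! ### Half-plane integrals of entire functions with Gaussian bounds -/

section HalfPlane

open Complex Filter Topology

variable {H : ℂ → ℂ} {a K M : ℝ}

theorem integrable_horizontal_of_gaussian_bound (hH : Continuous H) (ha : 0 < a)
    (hb : ∀ z, ‖H z‖ ≤ Real.exp (-(a / 2) * z.re ^ 2) * Real.exp (K / 2 * z.im ^ 2)) (v : ℝ) :
    Integrable fun x : ℝ => H (x + v * I) := by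
  refine ((integrable_exp_neg_mul_sq (half_pos ha)).mul_const (Real.exp (K / 2 * v ^ 2))).mono'
    (by fun_prop) (Eventually.of_forall fun x => ?_)
  simpa using hb (x + v * I)

/-- Cauchy's theorem on the rectangle with corners `0` and `R + v i`; the side at `Re z = R`
vanishes as `R → ∞` by the Gaussian bound. -/
theorem integral_Ioi_add_mul_I (hH : Differentiable ℂ H) (ha : 0 < a) (hK : 0 ≤ K)
    (hb : ∀ z, ‖H z‖ ≤ Real.exp (-(a / 2) * z.re ^ 2) * Real.exp (K / 2 * z.im ^ 2)) (v : ℝ) :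
    ∫ x in Set.Ioi (0 : ℝ), H (x + v * I) =
      (∫ x in Set.Ioi (0 : ℝ), H x) - I * ∫ y in (0 : ℝ)..v, H (y * I) := by
  have hint (v : ℝ) := integrable_horizontal_of_gaussian_bound hH.continuous ha hb v
  have hrect (R : ℝ) : (∫ x in (0 : ℝ)..R, H x) - (∫ x in (0 : ℝ)..R, H (x + v * I)) +
      I * (∫ y in (0 : ℝ)..v, H (R + y * I)) - I * (∫ y in (0 : ℝ)..v, H (y * I)) = 0 := by
    simpa using integral_boundary_rect_eq_zero_of_differentiableOn H 0 (R + v * I)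
      hH.differentiableOn
  have h0 : Tendsto (fun R : ℝ => ∫ x in (0 : ℝ)..R, H x) atTop
      (𝓝 (∫ x in Set.Ioi (0 : ℝ), H x)) := by
    refine intervalIntegral_tendsto_integral_Ioi 0 ?_ tendsto_id
    simpa using (hint 0).integrableOn
  have hv : Tendsto (fun R : ℝ => ∫ x in (0 : ℝ)..R, H (x + v * I)) atTop
      (𝓝 (∫ x in Set.Ioi (0 : ℝ), H (x + v * I))) :=
    intervalIntegral_tendsto_integral_Ioi 0 (hint v).integrableOn tendsto_id
  have hR : Tendsto (fun R : ℝ => ∫ y in (0 : ℝ)..v, H (R + y * I)) atTop (𝓝 0) := by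
    have hbound (R : ℝ) : ‖∫ y in (0 : ℝ)..v, H (R + y * I)‖ ≤
        Real.exp (-(a / 2) * R ^ 2) * Real.exp (K / 2 * v ^ 2) * |v - 0| := by
      refine intervalIntegral.norm_integral_le_of_norm_le_const fun y hy => ?_
      refine (hb _).trans ?_
      have hy2 : y ^ 2 ≤ v ^ 2 := by
        rcases Set.mem_uIoc.1 hy with h | h <;> nlinarith
      simp only [add_re, ofReal_re, mul_re, I_re, mul_zero, ofReal_im, I_im, mul_one, sub_self,
        add_zero, add_im, mul_im, zero_add]
      gcongr
    refine squeeze_zero_norm hbound ?_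
    have h1 : Tendsto (fun R : ℝ => Real.exp (-(a / 2) * R ^ 2)) atTop (𝓝 0) := by
      refine Real.tendsto_exp_atBot.comp ?_
      exact (tendsto_pow_atTop two_ne_zero).const_mul_atTop_of_neg (by linarith)
    simpa using (h1.mul_const _).mul_const |v - 0|
  have hlim := ((h0.sub hv).add (hR.const_mul I)).sub_const (I * ∫ y in (0 : ℝ)..v, H (y * I))
  have := tendsto_nhds_unique (hlim.congr hrect) tendsto_const_nhds
  linear_combination -this

/-- Integrability over the region `0 < y ≤ v`, in the coordinates `(v, y)`. -/
theorem integrable_indicator_gaussian_mul {q : ℝ → ℂ} (hq : Continuous q) (hK : 0 ≤ K)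
    (hM : K < M) (hb : ∀ y, ‖q y‖ ≤ Real.exp (K / 2 * y ^ 2)) :
    Integrable (Set.indicator {p : ℝ × ℝ | 0 < p.2 ∧ p.2 ≤ p.1}
      fun p => cexp (-(M * (p.1 : ℂ) ^ 2) / 2) * q p.2) (volume.prod volume) := by
  have hT : MeasurableSet {p : ℝ × ℝ | 0 < p.2 ∧ p.2 ≤ p.1} :=
    (measurableSet_lt measurable_const measurable_snd).inter
      (measurableSet_le measurable_snd measurable_fst)
  -- On `0 < y ≤ v`: `-M v² / 2 + K y² / 2 ≤ -(M - K) v² / 2 ≤ -(M - K) (v² + y²) / 4`.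
  have hc : 0 < (M - K) / 4 := by linarith
  refine ((integrable_exp_neg_mul_sq hc).mul_prod (integrable_exp_neg_mul_sq hc)).mono'
    (Continuous.aestronglyMeasurable (by fun_prop) |>.indicator hT)
    (Eventually.of_forall fun p => ?_)
  by_cases hp : p ∈ {p : ℝ × ℝ | 0 < p.2 ∧ p.2 ≤ p.1}
  · rw [Set.indicator_of_mem hp, norm_mul, norm_exp]
    have hp2 : p.2 ^ 2 ≤ p.1 ^ 2 := by
      have := hp.1
      have := hp.2
      nlinarith
    calc _ ≤ Real.exp (-(M * (p.1 : ℂ) ^ 2) / 2 : ℂ).re * Real.exp (K / 2 * p.2 ^ 2) := by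
          gcongr
          exact hb _
      _ ≤ _ := by
          rw [← Real.exp_add, ← Real.exp_add]
          refine Real.exp_le_exp.2 ?_
          have : (-(M * (p.1 : ℂ) ^ 2) / 2 : ℂ) = ((-(M * p.1 ^ 2) / 2 : ℝ) : ℂ) := by push_cast; rfl
          rw [this, ofReal_re]
          nlinarith
  · rw [Set.indicator_of_notMem hp, norm_zero]
    positivity

theorem integral_gaussian_Ici (hM : 0 < M) (y : ℝ) :
    ∫ v in Set.Ici y, cexp (-(M * (v : ℂ) ^ 2) / 2) =
      (Real.sqrt (2 * Real.pi / M) : ℂ) * complexPhi (-(Real.sqrt M : ℂ) * y) := by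
  have h := complexPhi_mul_sqrt hM (Or.inr rfl : (-1 : ℝ) = 1 ∨ (-1 : ℝ) = -1) (y : ℂ)
  have hset : {x : ℝ | -1 * x ≤ 0} = Set.Ici 0 := by
    ext x
    simp
  rw [hset] at h
  have e : (((-1 : ℝ) : ℂ) * (Real.sqrt M : ℂ) * y) = -(Real.sqrt M : ℂ) * y := by
    push_cast
    ring
  rw [← e, ← h, ← integral_indicator measurableSet_Ici, ← integral_indicator measurableSet_Ici,
    ← integral_add_right_eq_self _ y]
  congr 1
  ext x
  simp only [Set.indicator, Set.mem_Ici, le_add_iff_nonneg_left, ofReal_add]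

/-- Fubini on `0 < y ≤ v`: for fixed `y` the integral over `v ≥ y` is a Gaussian tail, hence a value
of `Φ`. -/
theorem integrableOn_and_integral_gaussian_mul_primitive {q : ℝ → ℂ} (hq : Continuous q)
    (hK : 0 ≤ K) (hM : K < M) (hb : ∀ y, ‖q y‖ ≤ Real.exp (K / 2 * y ^ 2)) :
    IntegrableOn (fun y : ℝ => complexPhi (-(Real.sqrt M : ℂ) * y) * q y) (Set.Ioi 0) ∧
      ∫ v in Set.Ioi (0 : ℝ), cexp (-(M * (v : ℂ) ^ 2) / 2) * ∫ y in (0 : ℝ)..v, q y =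
        (Real.sqrt (2 * Real.pi / M) : ℂ) *
          ∫ y in Set.Ioi (0 : ℝ), complexPhi (-(Real.sqrt M : ℂ) * y) * q y := by
  have hM0 : 0 < M := hK.trans_lt hM
  have hi := integrable_indicator_gaussian_mul hq hK hM hb
  have hv (v : ℝ) : ∫ y, Set.indicator {p : ℝ × ℝ | 0 < p.2 ∧ p.2 ≤ p.1}
      (fun p => cexp (-(M * (p.1 : ℂ) ^ 2) / 2) * q p.2) (v, y) =
      Set.indicator (Set.Ioi 0)
        (fun v : ℝ => cexp (-(M * (v : ℂ) ^ 2) / 2) * ∫ y in (0 : ℝ)..v, q y) v := by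
    have h1 (y : ℝ) : Set.indicator {p : ℝ × ℝ | 0 < p.2 ∧ p.2 ≤ p.1}
      (fun p => cexp (-(M * (p.1 : ℂ) ^ 2) / 2) * q p.2) (v, y) =
      Set.indicator (Set.Ioc (0 : ℝ) v) (fun y : ℝ => cexp (-(M * (v : ℂ) ^ 2) / 2) * q y) y := rfl
    simp_rw [h1]
    rw [integral_indicator measurableSet_Ioc, integral_const_mul]
    by_cases hv : 0 < v
    · rw [Set.indicator_of_mem (Set.mem_Ioi.2 hv), intervalIntegral.integral_of_le hv.le]
    · rw [Set.indicator_of_notMem (by simpa using hv), Set.Ioc_eq_empty hv]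
      simp
  have hy (y : ℝ) : ∫ v, Set.indicator {p : ℝ × ℝ | 0 < p.2 ∧ p.2 ≤ p.1}
      (fun p => cexp (-(M * (p.1 : ℂ) ^ 2) / 2) * q p.2) (v, y) =
      (Real.sqrt (2 * Real.pi / M) : ℂ) * Set.indicator (Set.Ioi 0)
        (fun y : ℝ => complexPhi (-(Real.sqrt M : ℂ) * y) * q y) y := by
    by_cases hy : 0 < y
    · have h1 (v : ℝ) : Set.indicator {p : ℝ × ℝ | 0 < p.2 ∧ p.2 ≤ p.1}
        (fun p => cexp (-(M * (p.1 : ℂ) ^ 2) / 2) * q p.2) (v, y) =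
        Set.indicator (Set.Ici y) (fun v : ℝ => cexp (-(M * (v : ℂ) ^ 2) / 2) * q y) v := by
        simp [Set.indicator, hy]
      simp_rw [h1]
      rw [integral_indicator measurableSet_Ici, integral_mul_const, integral_gaussian_Ici hM0,
        Set.indicator_of_mem (Set.mem_Ioi.2 hy)]
      ring
    · have h1 (v : ℝ) : Set.indicator {p : ℝ × ℝ | 0 < p.2 ∧ p.2 ≤ p.1}
        (fun p => cexp (-(M * (p.1 : ℂ) ^ 2) / 2) * q p.2) (v, y) = 0 := by
        simp [Set.indicator, hy]
      simp_rw [h1]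
      rw [Set.indicator_of_notMem (by simpa using hy)]
      simp
  have hs := integral_prod_symm _ hi
  rw [integral_prod _ hi] at hs
  have hr := hi.integral_prod_right
  simp_rw [hv, hy] at hs
  simp_rw [hy] at hr
  have hc : (Real.sqrt (2 * Real.pi / M) : ℂ) ≠ 0 := by
    have : 0 < Real.sqrt (2 * Real.pi / M) := by positivity
    exact_mod_cast this.ne'
  rw [integrable_const_mul_iff hc.isUnit, integrable_indicator_iff measurableSet_Ioi] at hr
  refine ⟨hr, ?_⟩
  rwa [integral_const_mul, integral_indicator measurableSet_Ioi,
    integral_indicator measurableSet_Ioi] at hs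

theorem integral_halfPlane_eq (hH : Differentiable ℂ H) (ha : 0 < a) (hK : 0 ≤ K) (hM : K < M)
    (hb : ∀ z, ‖H z‖ ≤ Real.exp (-(a / 2) * z.re ^ 2) * Real.exp (K / 2 * z.im ^ 2))
    (hconj : ∀ y : ℝ, H (-(y * I)) = (starRingEnd ℂ) (H (y * I)))
    (hi : Integrable (fun p : ℝ × ℝ => H (-p.1 + p.2 * I) * cexp (-(M * (p.2 : ℂ) ^ 2) / 2))
      ((volume.restrict (Set.Iic 0)).prod volume)) :
    ∫ p : ℝ × ℝ, H (-p.1 + p.2 * I) * cexp (-(M * (p.2 : ℂ) ^ 2) / 2)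
        ∂((volume.restrict (Set.Iic 0)).prod volume) =
      (Real.sqrt (2 * Real.pi / M) : ℂ) * ((∫ x in Set.Ioi (0 : ℝ), H x) +
        2 * ∫ y in Set.Ioi (0 : ℝ), complexPhi (-(Real.sqrt M : ℂ) * y) *
          ((H (y * I)).im : ℂ)) := by
  have hM0 : 0 < M := hK.trans_lt hM
  have hHc := hH.continuous
  have hinner (v : ℝ) : ∫ t in Set.Iic (0 : ℝ), H (-t + v * I) * cexp (-(M * (v : ℂ) ^ 2) / 2) =
      cexp (-(M * (v : ℂ) ^ 2) / 2) * (∫ x in Set.Ioi (0 : ℝ), H x) -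
        I * (cexp (-(M * (v : ℂ) ^ 2) / 2) * ∫ y in (0 : ℝ)..v, H (y * I)) := by
    rw [integral_mul_const]
    have h1 := integral_comp_neg_Iic (0 : ℝ) fun x : ℝ => H (x + v * I)
    simp only [ofReal_neg, neg_zero] at h1
    rw [h1, integral_Ioi_add_mul_I hH ha hK hb]
    ring
  have hgauss : Integrable fun v : ℝ => cexp (-(M * (v : ℂ) ^ 2) / 2) := by
    simpa using integrable_cexp_neg_mul_sq_div_two hM0 0
  have hgauss_int : ∫ v : ℝ, cexp (-(M * (v : ℂ) ^ 2) / 2) = (Real.sqrt (2 * Real.pi / M) : ℂ) := by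
    have := integral_cexp_quadratic_of_pos hM0 0 0
    simp only [zero_mul, add_zero, ne_eq, OfNat.ofNat_ne_zero, not_false_eq_true, zero_pow,
      zero_div, Complex.exp_zero, mul_one] at this
    rw [← this]
    congr 1
    ext v
    congr 1
    ring
  have hr := hi.integral_prod_right
  simp only [hinner] at hr
  -- No bound on the primitive is needed: it is the difference of a Gaussian term and the fibre
  -- integrals, integrable by Fubini.
  have hprim : Integrable fun v : ℝ =>
      I * (cexp (-(M * (v : ℂ) ^ 2) / 2) * ∫ y in (0 : ℝ)..v, H (y * I)) := by
    refine ((hgauss.mul_const (∫ x in Set.Ioi (0 : ℝ), H x)).sub hr).congr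
      (Eventually.of_forall fun v => ?_)
    simp
  rw [integral_prod_symm _ hi]
  simp only [hinner]
  rw [integral_sub (hgauss.mul_const _) hprim, integral_mul_const, hgauss_int]
  have hsplit := intervalIntegral.integral_Iic_add_Ioi (b := (0 : ℝ)) hprim.integrableOn
    hprim.integrableOn
  have hneg := integral_comp_neg_Ioi (0 : ℝ) fun v : ℝ =>
      I * (cexp (-(M * (v : ℂ) ^ 2) / 2) * ∫ y in (0 : ℝ)..v, H (y * I))
  rw [neg_zero] at hneg
  have hnegint : IntegrableOn (fun v : ℝ => I * (cexp (-(M * ((-v : ℝ) : ℂ) ^ 2) / 2) *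
      ∫ y in (0 : ℝ)..(-v), H (y * I))) (Set.Ioi 0) := hprim.comp_neg.integrableOn
  rw [← hneg, ← integral_add hnegint hprim.integrableOn] at hsplit
  -- Pairing `v` with `-v`: conjugation symmetry turns the difference of the primitives into `2i ∫
  -- Im H(iy)`.
  have hsum (v : ℝ) : I * (cexp (-(M * ((-v : ℝ) : ℂ) ^ 2) / 2) *
      ∫ y in (0 : ℝ)..(-v), H (y * I)) +
      I * (cexp (-(M * (v : ℂ) ^ 2) / 2) * ∫ y in (0 : ℝ)..v, H (y * I)) =
      -2 * (cexp (-(M * (v : ℂ) ^ 2) / 2) * ∫ y in (0 : ℝ)..v, ((H (y * I)).im : ℂ)) := by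
    have h1 : ∫ y in (0 : ℝ)..(-v), H (y * I) = -∫ y in (0 : ℝ)..v, H (-(y * I)) := by
      have := intervalIntegral.integral_comp_neg (a := 0) (b := v) fun y : ℝ => H (y * I)
      simp only [ofReal_neg, neg_mul, neg_zero] at this
      rw [this, intervalIntegral.integral_symm]
    have h2 : (∫ y in (0 : ℝ)..v, H (y * I)) - ∫ y in (0 : ℝ)..v, H (-(y * I)) =
        2 * I * ∫ y in (0 : ℝ)..v, ((H (y * I)).im : ℂ) := by
      rw [← intervalIntegral.integral_sub (Continuous.intervalIntegrable (by fun_prop) _ _)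
        (Continuous.intervalIntegrable (by fun_prop) _ _),
        ← intervalIntegral.integral_const_mul]
      congr 1
      ext y
      rw [hconj, sub_conj]
      push_cast
      ring
    rw [h1, ofReal_neg, neg_sq]
    linear_combination (I * cexp (-(M * (v : ℂ) ^ 2) / 2)) * h2 +
      (2 * cexp (-(M * (v : ℂ) ^ 2) / 2) * ∫ y in (0 : ℝ)..v, ((H (y * I)).im : ℂ)) * I_sq
  have hq := (integrableOn_and_integral_gaussian_mul_primitive
    (q := fun y => ((H (y * I)).im : ℂ)) (by fun_prop) hK hM fun y => by
      rw [norm_real]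
      refine (abs_im_le_norm _).trans ((hb _).trans_eq ?_)
      simp).2
  simp only [hsum] at hsplit
  rw [integral_const_mul, hq] at hsplit
  rw [← hsplit]
  ring

end HalfPlane

/-! ### Part (ii): one negative parameter -/

section NegativeEntry

open Complex

variable {n : ℕ}

/-- Writing `xₖ` as the total sum minus the other coordinates, Cauchy–Schwarz with weights `l₀` and
the positive `lᵢ` bounds `xₖ²` by `l₀ + ∑ lᵢ < -lₖ` times the positive part of the form. -/
theorem orthantCov_posDef_of_neg_entry {l₀ : ℝ} {l : Fin (n + 1) → ℝ} {k : Fin (n + 1)}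
    (h₀ : 0 < l₀) (hl : ∀ i, 0 < l (k.succAbove i)) (hk : l k < 0) (hs : l₀ + ∑ j, l j < 0) :
    (orthantCov l₀ l).PosDef := by
  refine orthantCov_posDef_of_forall_pos fun x hx => ?_
  rw [Fin.sum_univ_succAbove _ k] at hs
  rw [Fin.sum_univ_succAbove _ k, Fin.sum_univ_succAbove _ k]
  set L := ∑ i, l (k.succAbove i)
  set A := ∑ i, x (k.succAbove i)
  set B := ∑ i, x (k.succAbove i) ^ 2 / l (k.succAbove i)
  have hL : 0 ≤ L := Finset.sum_nonneg fun i _ => (hl i).le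
  have hB : 0 ≤ B := Finset.sum_nonneg fun i _ => div_nonneg (sq_nonneg _) (hl i).le
  have hA : A ^ 2 ≤ L * B := sum_sq_le_mul_sum_sq_div Finset.univ (fun i _ => hl i) _
  set T := (x k + A) ^ 2 / l₀ with hT
  have hT0 : 0 ≤ T := by positivity
  have hTl : (x k + A) ^ 2 = l₀ * T := by
    rw [hT]
    field_simp
  have hcs : x k ^ 2 ≤ (l₀ + L) * (T + B) := by
    have h1 : x k = (x k + A) + (-A) := by ring
    have h2 := sq_nonneg ((x k + A) * L + l₀ * A)
    -- The inequality is proved after multiplication by `l₀ L`; `L = 0` is treated apart, as no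
    -- division by `L` is possible there.
    by_cases hL0 : L = 0
    · have hA0 : A = 0 := by
        rw [hL0, zero_mul] at hA
        exact pow_eq_zero_iff two_ne_zero |>.1 (le_antisymm hA (sq_nonneg _))
      rw [hL0, add_zero]
      rw [hA0, add_zero] at hTl
      nlinarith
    · have hLpos : 0 < L := lt_of_le_of_ne hL (Ne.symm hL0)
      have h3 : 0 ≤ l₀ * L * ((l₀ + L) * (T + B) - x k ^ 2) := by
        have e : l₀ * L * ((l₀ + L) * (T + B) - x k ^ 2) =
            ((x k + A) * L + l₀ * A) ^ 2 + l₀ * (l₀ + L) * (L * B - A ^ 2) := by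
          linear_combination (-(L * (l₀ + L))) * hTl
        rw [e]
        have : 0 ≤ l₀ * (l₀ + L) * (L * B - A ^ 2) := by
          have : 0 ≤ L * B - A ^ 2 := by linarith
          positivity
        linarith
      have h4 := nonneg_of_mul_nonneg_right h3 (mul_pos h₀ hLpos)
      linarith
  have hTB : 0 < T + B := by
    by_contra! hle
    have hT1 : T = 0 := by linarith
    have hB1 : B = 0 := by linarith
    have hxk : x k = 0 := by
      have : x k ^ 2 ≤ 0 := by
        refine hcs.trans_eq ?_
        rw [hT1, hB1]
        ring
      exact pow_eq_zero_iff two_ne_zero |>.1 (le_antisymm this (sq_nonneg _))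
    refine hx (funext fun j => ?_)
    rcases Fin.eq_self_or_eq_succAbove k j with rfl | ⟨i, rfl⟩
    · exact hxk
    · have h5 := (Finset.sum_eq_zero_iff_of_nonneg fun i _ =>
        div_nonneg (sq_nonneg (x (k.succAbove i))) (hl i).le).1 hB1 i (Finset.mem_univ i)
      simpa [(hl i).ne'] using h5
  have h6 : x k ^ 2 < (-l k) * (T + B) :=
    hcs.trans_lt (mul_lt_mul_of_pos_right (by linarith) hTB)
  have h7 : x k ^ 2 / (-l k) < T + B := by
    rw [div_lt_iff₀ (by linarith)]
    linarith
  rw [div_neg] at h7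
  linarith

theorem complexPhi_conj (z : ℂ) :
    complexPhi ((starRingEnd ℂ) z) = (starRingEnd ℂ) (complexPhi z) := by
  rw [complexPhi_eq_integral_Iic, complexPhi_eq_integral_Iic, map_mul, ← integral_conj]
  congr 1
  · simp
  · congr 1
    ext x
    rw [← exp_conj]
    simp [conj_ofNat]

/-- The analytic integrand `exp (-l₀ z² / 2) ∏ Φ (eⱼ √lⱼ z)`. -/
noncomputable def gaussianPhiProd (l₀ : ℝ) (l e : Fin n → ℝ) (z : ℂ) : ℂ :=
  cexp (-(l₀ * z ^ 2) / 2) * ∏ j, complexPhi ((e j : ℂ) * (Real.sqrt (l j) : ℂ) * z)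

theorem differentiable_gaussianPhiProd (l₀ : ℝ) (l e : Fin n → ℝ) :
    Differentiable ℂ (gaussianPhiProd l₀ l e) := by
  have h (j : Fin n) : Differentiable ℂ fun z : ℂ =>
      complexPhi ((e j : ℂ) * (Real.sqrt (l j) : ℂ) * z) :=
    differentiable_complexPhi.comp (by fun_prop)
  unfold gaussianPhiProd
  fun_prop

theorem norm_gaussianPhiProd_le {l₀ : ℝ} {l e : Fin n → ℝ} (hl : ∀ j, 0 < l j)
    (he : ∀ j, e j = 1 ∨ e j = -1) (z : ℂ) :
    ‖gaussianPhiProd l₀ l e z‖ ≤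
      Real.exp (-(l₀ / 2) * z.re ^ 2) * Real.exp ((l₀ + ∑ j, l j) / 2 * z.im ^ 2) := by
  have h1 : ‖cexp (-(l₀ * z ^ 2) / 2)‖ =
      Real.exp (-(l₀ / 2) * z.re ^ 2) * Real.exp (l₀ * z.im ^ 2 / 2) := by
    simpa using norm_cexp_neg_mul_sq_div_two l₀ z 0
  rw [gaussianPhiProd, norm_mul, norm_prod, h1, mul_assoc]
  refine mul_le_mul_of_nonneg_left ?_ (Real.exp_pos _).le
  have h2 : ∏ j, ‖complexPhi ((e j : ℂ) * (Real.sqrt (l j) : ℂ) * z)‖ ≤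
      ∏ j, Real.exp (l j * z.im ^ 2 / 2) := by
    gcongr with j
    refine (norm_complexPhi_le _).trans_eq ?_
    have h3 : ((e j : ℂ) * (Real.sqrt (l j) : ℂ) * z).im = e j * Real.sqrt (l j) * z.im := by
      rw [← ofReal_mul, im_ofReal_mul]
    have h4 : e j ^ 2 = 1 := by
      rcases he j with h | h <;> simp [h]
    rw [h3, mul_pow, mul_pow, h4, Real.sq_sqrt (hl j).le, one_mul]
  calc _ ≤ Real.exp (l₀ * z.im ^ 2 / 2) * ∏ j, Real.exp (l j * z.im ^ 2 / 2) := by gcongr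
    _ = _ := by
      rw [← Real.exp_sum, ← Real.exp_add, ← Finset.sum_div, ← Finset.sum_mul]
      congr 1
      ring

theorem gaussianPhiProd_conj (l₀ : ℝ) (l e : Fin n → ℝ) (z : ℂ) :
    gaussianPhiProd l₀ l e ((starRingEnd ℂ) z) = (starRingEnd ℂ) (gaussianPhiProd l₀ l e z) := by
  rw [gaussianPhiProd, gaussianPhiProd, map_mul, map_prod, ← exp_conj]
  congr 1
  · simp [conj_ofNat]
  · refine Finset.prod_congr rfl fun j _ => ?_
    rw [← complexPhi_conj]
    simp

/-- Along `z = -t + i v` one has `t + z = i v`, so `exp (-M v² / 2)` is the factor of the coordinate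
`t` with parameter `-M`. The total rate in `v` is `M - l₀ - ∑ lⱼ`, positive by `hs`. -/
theorem integral_cexp_mul_prod_cexp_of_neg_entry {l₀ M : ℝ} {l : Fin n → ℝ} (t : ℝ)
    (hs : l₀ + ∑ j, l j < M) (y : Fin n → ℝ) :
    ∫ v : ℝ, (cexp (-(l₀ * (-t + v * I) ^ 2) / 2) * cexp (-(M * (v : ℂ) ^ 2) / 2)) *
        ∏ j, cexp (-(l j * ((y j : ℂ) + (-t + v * I)) ^ 2) / 2) =
      (Real.sqrt (2 * Real.pi / (M - l₀ - ∑ j, l j)) : ℂ) * (Real.exp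
        (-((-M * t ^ 2 + ∑ j, l j * y j ^ 2) - (-M * t + ∑ j, l j * y j) ^ 2 /
          (l₀ + (-M + ∑ j, l j))) / 2) : ℝ) := by
  have hb : 0 < M - l₀ - ∑ j, l j := by linarith
  have h (v : ℝ) : (cexp (-(l₀ * (-t + v * I) ^ 2) / 2) * cexp (-(M * (v : ℂ) ^ 2) / 2)) *
        ∏ j, cexp (-(l j * ((y j : ℂ) + (-t + v * I)) ^ 2) / 2) =
      cexp (-(((M - l₀ - ∑ j, l j : ℝ) : ℂ) / 2) * (v : ℂ) ^ 2 +
        (-I * ((∑ j, (l j : ℂ) * y j) - (l₀ + ∑ j, (l j : ℂ)) * t)) * v +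
        (-(l₀ * t ^ 2 + (∑ j, (l j : ℂ) * y j ^ 2) - 2 * t * (∑ j, (l j : ℂ) * y j) +
          (∑ j, (l j : ℂ)) * t ^ 2) / 2)) := by
    rw [← exp_sum, ← exp_add, ← exp_add]
    congr 1
    have h1 (j : Fin n) : -((l j : ℂ) * ((y j : ℂ) + (-t + v * I)) ^ 2) / 2 =
        (l j * y j ^ 2) * (-1 / 2) + (l j * y j) * (-(-t + v * I)) +
          l j * (-(-t + v * I) ^ 2 / 2) := by
      ring
    simp_rw [h1]
    rw [Finset.sum_add_distrib, Finset.sum_add_distrib, ← Finset.sum_mul, ← Finset.sum_mul,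
      ← Finset.sum_mul]
    push_cast
    linear_combination (-(v : ℂ) ^ 2 / 2 * (l₀ + ∑ j, (l j : ℂ))) * I_sq
  simp_rw [h]
  rw [integral_cexp_quadratic_of_pos hb]
  congr 1
  have hbc : ((M : ℂ) - l₀ - ∑ j, (l j : ℂ)) ≠ 0 := by exact_mod_cast hb.ne'
  have hbc' : (l₀ : ℂ) + (-M + ∑ j, (l j : ℂ)) ≠ 0 := by
    intro h
    exact hbc (by linear_combination -h)
  push_cast
  congr 1
  have hE : (l₀ : ℂ) + (-M + ∑ j, (l j : ℂ)) = -((M : ℂ) - l₀ - ∑ j, (l j : ℂ)) := by ring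
  rw [hE, mul_pow, neg_sq, I_sq]
  field_simp
  ring

/-- Fubini in `(y, t, v)`: integrating `v` first recovers the density in `(t, y)`, integrating `y`
first gives the `Φ` factors of `gaussianPhiProd`. -/
theorem orthantProb_eq_integral_halfPlane {l₀ : ℝ} {l e : Fin (n + 1) → ℝ} {k : Fin (n + 1)}
    (h₀ : 0 < l₀) (hl : ∀ i, 0 < l (k.succAbove i)) (hk : l k < 0) (hs : l₀ + ∑ j, l j < 0)
    (he : ∀ j, e j = 1 ∨ e j = -1) (hek : e k = 1) :
    Integrable (fun p : ℝ × ℝ => gaussianPhiProd l₀ (fun i => l (k.succAbove i))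
        (fun i => e (k.succAbove i)) (-p.1 + p.2 * I) * cexp (-((-l k : ℝ) * (p.2 : ℂ) ^ 2) / 2))
      ((volume.restrict (Set.Iic 0)).prod volume) ∧
    (orthantProb l₀ l e : ℂ) = (Real.sqrt l₀ * Real.sqrt (-l k) / (2 * Real.pi) : ℝ) *
      ∫ p : ℝ × ℝ, gaussianPhiProd l₀ (fun i => l (k.succAbove i))
        (fun i => e (k.succAbove i)) (-p.1 + p.2 * I) * cexp (-((-l k : ℝ) * (p.2 : ℂ) ^ 2) / 2)
      ∂((volume.restrict (Set.Iic 0)).prod volume) := by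
  have hS := orthantCov_posDef_of_neg_entry h₀ hl hk hs
  have hlne (j : Fin (n + 1)) : l j ≠ 0 := by
    rcases Fin.eq_self_or_eq_succAbove k j with rfl | ⟨i, rfl⟩
    · exact hk.ne
    · exact (hl i).ne'
  have hprob := orthantProb_eq_integral hS h₀.ne' hlne hs.ne e
  simp only [Fin.sum_univ_succAbove _ k, Fin.prod_univ_succAbove _ k] at hprob hs
  obtain ⟨M, hMk⟩ : ∃ M, l k = -M := ⟨-l k, by ring⟩
  rw [hMk] at hk hs hprob ⊢
  rw [neg_neg]
  have hM : 0 < M := by linarith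
  set m : Fin n → ℝ := fun i => l (k.succAbove i)
  set f : Fin n → ℝ := fun i => e (k.succAbove i)
  have hfe (i : Fin n) : f i = 1 ∨ f i = -1 := he _
  have hlm (i : Fin n) : 0 < m i := hl i
  have hml (i : Fin n) : l (k.succAbove i) = m i := rfl
  have hfe' (i : Fin n) : e (k.succAbove i) = f i := rfl
  clear_value m f
  have hss : l₀ + ∑ i, m i < M := by linarith
  have hsr : 0 < M - l₀ - ∑ i, m i := by linarith
  have hset : {x : ℝ | 1 * x ≤ 0} = Set.Iic 0 := by
    ext x
    simp
  have hweight (p : ℝ × ℝ) : ‖cexp (-(l₀ * (-(p.1 : ℂ) + p.2 * I) ^ 2) / 2) *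
      cexp (-(M * (p.2 : ℂ) ^ 2) / 2)‖ *
      Real.exp ((∑ j, m j) * (-(p.1 : ℂ) + p.2 * I).im ^ 2 / 2) =
      Real.exp (-(l₀ / 2) * p.1 ^ 2) * Real.exp (-((M - l₀ - ∑ i, m i) / 2) * p.2 ^ 2) := by
    have h1 := norm_cexp_neg_mul_sq_div_two l₀ (-(p.1 : ℂ) + p.2 * I) 0
    have h2 := norm_cexp_neg_mul_sq_div_two M 0 p.2
    simp only [ofReal_zero, zero_add, add_re, neg_re, ofReal_re, mul_re, I_re, mul_zero,
      ofReal_im, I_im, mul_one, sub_self, add_zero, add_im, neg_im, neg_zero, mul_im, neg_sq,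
      zero_re, zero_im] at h1 h2 ⊢
    rw [norm_mul, h1, h2, ← Real.exp_add, ← Real.exp_add, ← Real.exp_add, ← Real.exp_add,
      ← Real.exp_add]
    congr 1
    ring
  have hi := integrable_mul_prod_cexp (e := f) (l := m)
    (ν := (volume.restrict (Set.Iic (0 : ℝ))).prod (volume : Measure ℝ))
    (Z := fun p : ℝ × ℝ => -(p.1 : ℂ) + p.2 * I)
    (W := fun p : ℝ × ℝ => cexp (-(l₀ * (-(p.1 : ℂ) + p.2 * I) ^ 2) / 2) *
      cexp (-(M * (p.2 : ℂ) ^ 2) / 2)) hlm (by fun_prop) (by fun_prop)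
    (((integrable_exp_neg_mul_sq (half_pos h₀)).integrableOn.mul_prod
      (integrable_exp_neg_mul_sq (half_pos hsr))).congr
      (Filter.Eventually.of_forall fun p => (hweight p).symm))
  have hG (p : ℝ × ℝ) : (cexp (-(l₀ * (-(p.1 : ℂ) + p.2 * I) ^ 2) / 2) *
      cexp (-(M * (p.2 : ℂ) ^ 2) / 2)) *
        ∏ j, complexPhi ((f j : ℂ) * (Real.sqrt (m j) : ℂ) * (-(p.1 : ℂ) + p.2 * I)) =
      gaussianPhiProd l₀ m f (-p.1 + p.2 * I) * cexp (-(M * (p.2 : ℂ) ^ 2) / 2) := by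
    rw [gaussianPhiProd]
    ring
  have hsy := integral_prod_symm _ hi
  have hr := hi.integral_prod_right
  simp only [integral_mul_prod_cexp hlm hfe, hG] at hsy hr
  have hprod : (∏ j, (Real.sqrt (2 * Real.pi / m j) : ℂ)) ≠ 0 :=
    Finset.prod_ne_zero_iff.2 fun j _ => by
      have := Real.sqrt_pos.2 (div_pos (mul_pos two_pos Real.pi_pos) (hlm j))
      exact_mod_cast this.ne'
  refine ⟨(integrable_const_mul_iff hprod.isUnit _).1 hr, ?_⟩
  -- Regrouping `(y, (t, v))` as `((y, t), v)` lets `v` be the inner variable.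
  have hassoc := measurePreserving_prodAssoc (Measure.pi fun j => halfLineMeasure (f j))
    (volume.restrict (Set.Iic (0 : ℝ))) (volume : Measure ℝ)
  have hi2 : Integrable (fun q : ((Fin n → ℝ) × ℝ) × ℝ =>
      ((cexp (-(l₀ * (-(q.1.2 : ℂ) + q.2 * I) ^ 2) / 2) *
      cexp (-(M * (q.2 : ℂ) ^ 2) / 2)) *
        ∏ j, cexp (-(m j * ((q.1.1 j : ℂ) + (-(q.1.2 : ℂ) + q.2 * I)) ^ 2) / 2))) (((Measure.pi fun j => halfLineMeasure (f j)).prod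
        (volume.restrict (Set.Iic (0 : ℝ)))).prod volume) :=
    (hassoc.integrable_comp_emb (MeasurableEquiv.measurableEmbedding _)).2 hi
  have hsy2 := (hassoc.integral_comp' _).trans hsy
  change ∫ q : ((Fin n → ℝ) × ℝ) × ℝ, ((cexp (-(l₀ * (-(q.1.2 : ℂ) + q.2 * I) ^ 2) / 2) *
      cexp (-(M * (q.2 : ℂ) ^ 2) / 2)) *
        ∏ j, cexp (-(m j * ((q.1.1 j : ℂ) + (-(q.1.2 : ℂ) + q.2 * I)) ^ 2) / 2))
      ∂(((Measure.pi fun j => halfLineMeasure (f j)).prod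
        (volume.restrict (Set.Iic (0 : ℝ)))).prod volume) = _ at hsy2
  rw [integral_prod _ hi2] at hsy2
  simp only [integral_cexp_mul_prod_cexp_of_neg_entry _ hss] at hsy2
  rw [integral_const_mul, integral_const_mul, integral_complex_ofReal,
    ← integral_prod_swap] at hsy2
  have hpi := (measurePreserving_piFinSuccAbove (fun j => halfLineMeasure (e j)) k).symm
  rw [← hpi.integral_comp'] at hprob
  simp only [MeasurableEquiv.piFinSuccAbove_symm_apply, Fin.insertNthEquiv_apply,
    Fin.insertNth_apply_same, Fin.insertNth_apply_succAbove, hek, hml, hfe'] at hprob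
  simp only [Prod.fst_swap, Prod.snd_swap] at hsy2
  rw [halfLineMeasure, hset] at hprob
  set J := ∫ x : ℝ × (Fin n → ℝ), Real.exp (-(-M * x.1 ^ 2 + ∑ i, m i * x.2 i ^ 2 -
      (-M * x.1 + ∑ i, m i * x.2 i) ^ 2 / (l₀ + (-M + Finset.univ.sum m))) / 2)
    ∂(volume.restrict (Set.Iic 0)).prod (Measure.pi fun j => halfLineMeasure (f j))
  set D := ∫ p : ℝ × ℝ, gaussianPhiProd l₀ m f (-p.1 + p.2 * I) *
    cexp (-(M * (p.2 : ℂ) ^ 2) / 2) ∂(volume.restrict (Set.Iic 0)).prod volume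
  clear_value J D
  have hP : 0 < ∏ j, m j := Finset.prod_pos fun j _ => hlm j
  -- Numerator and denominator are both negative; the signs are cancelled before square roots are
  -- split.
  have hratio : (l₀ + (-M + Finset.univ.sum m)) / (l₀ * (-M * Finset.univ.prod m)) =
      (M - l₀ - ∑ i, m i) / (l₀ * M * ∏ j, m j) := by
    rw [← neg_div_neg_eq]
    congr 1 <;> ring
  rw [hratio] at hprob
  generalize M - l₀ - ∑ i, m i = b at *
  rw [← ofReal_prod, prod_sqrt_two_pi_div hlm, Real.sqrt_div (by positivity)] at hsy2
  rw [hprob, Real.sqrt_div hsr.le, Real.sqrt_mul (by positivity), Real.sqrt_mul h₀.le]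
  have hsq : Real.sqrt (2 * Real.pi) ^ 2 = 2 * Real.pi := Real.sq_sqrt (by positivity)
  rw [show Real.sqrt l₀ * Real.sqrt M / (2 * Real.pi) =
    Real.sqrt l₀ * Real.sqrt M / Real.sqrt (2 * Real.pi) ^ 2 by rw [hsq]]
  have e1 : (Real.sqrt l₀ : ℂ) ≠ 0 := by exact_mod_cast (Real.sqrt_pos.2 h₀).ne'
  have e2 : (Real.sqrt b : ℂ) ≠ 0 := by exact_mod_cast (Real.sqrt_pos.2 hsr).ne'
  have e3 : (Real.sqrt (∏ j, m j) : ℂ) ≠ 0 := by exact_mod_cast (Real.sqrt_pos.2 hP).ne'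
  have e4 : (Real.sqrt (2 * Real.pi) : ℂ) ≠ 0 := by
    exact_mod_cast (Real.sqrt_pos.2 (mul_pos two_pos Real.pi_pos)).ne'
  have e5 : (Real.sqrt M : ℂ) ≠ 0 := by exact_mod_cast (Real.sqrt_pos.2 hM).ne'
  push_cast at hsy2 ⊢
  field_simp at hsy2 ⊢
  linear_combination (Real.sqrt (2 * Real.pi) : ℂ) * hsy2

theorem integrableOn_and_orthantProb_eq_of_neg_entry {l₀ : ℝ} {l e : Fin (n + 1) → ℝ}
    {k : Fin (n + 1)} (h₀ : 0 < l₀) (hl : ∀ i, 0 < l (k.succAbove i)) (hk : l k < 0)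
    (hs : l₀ + ∑ j, l j < 0) (he : ∀ j, e j = 1 ∨ e j = -1) (hek : e k = 1) :
    let G := gaussianPhiProd l₀ (fun i => l (k.succAbove i)) fun i => e (k.succAbove i)
    IntegrableOn (fun y : ℝ => G y) (Set.Ioi 0) ∧
    IntegrableOn (fun y : ℝ => complexPhi (-(Real.sqrt (-l k) : ℂ) * y) * ((G (y * I)).im : ℂ))
      (Set.Ioi 0) ∧
    (orthantProb l₀ l e : ℂ) = (Real.sqrt (l₀ / (2 * Real.pi)) : ℂ) *
      ((∫ y in Set.Ioi (0 : ℝ), G y) + 2 * ∫ y in Set.Ioi (0 : ℝ),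
        complexPhi (-(Real.sqrt (-l k) : ℂ) * y) * ((G (y * I)).im : ℂ)) := by
  intro G
  have hd : Differentiable ℂ G := differentiable_gaussianPhiProd _ _ _
  have hb := norm_gaussianPhiProd_le (l₀ := l₀) (e := fun i => e (k.succAbove i)) hl
    fun i => he _
  have hK : 0 ≤ l₀ + ∑ i, l (k.succAbove i) :=
    add_nonneg h₀.le (Finset.sum_nonneg fun i _ => (hl i).le)
  have hKM : l₀ + ∑ i, l (k.succAbove i) < -l k := by
    rw [Fin.sum_univ_succAbove _ k] at hs
    linarith
  have hconj (y : ℝ) : G (-(y * I)) = (starRingEnd ℂ) (G (y * I)) := by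
    rw [← gaussianPhiProd_conj]
    congr 1
    simp
  obtain ⟨hi, hprob⟩ := orthantProb_eq_integral_halfPlane h₀ hl hk hs he hek
  have hc := hd.continuous
  refine ⟨?_, ?_, ?_⟩
  · simpa using (integrable_horizontal_of_gaussian_bound hc h₀ hb 0).integrableOn (s := Set.Ioi 0)
  · refine (integrableOn_and_integral_gaussian_mul_primitive
      (q := fun y : ℝ => ((G (y * I)).im : ℂ)) (by fun_prop) hK hKM fun y => ?_).1
    rw [norm_real]
    refine (abs_im_le_norm _).trans ((hb _).trans_eq ?_)
    simp
  · rw [hprob, integral_halfPlane_eq hd h₀ hK hKM hb hconj hi, ← mul_assoc]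
    congr 1
    have hM : 0 < -l k := by linarith
    rw [← ofReal_mul, ofReal_inj, Real.sqrt_div (by positivity), Real.sqrt_div h₀.le]
    have hsq : Real.sqrt (2 * Real.pi) ^ 2 = 2 * Real.pi := Real.sq_sqrt (by positivity)
    have h1 := Real.sqrt_pos.2 hM
    have h2 : 0 < Real.sqrt (2 * Real.pi) := by positivity
    rw [show Real.sqrt l₀ * Real.sqrt (-l k) / (2 * Real.pi) =
      Real.sqrt l₀ * Real.sqrt (-l k) / Real.sqrt (2 * Real.pi) ^ 2 by rw [hsq]]
    field_simp

theorem prod_univ_erase_eq_prod_succAbove {R : Type*} [CommMonoid R] (k : Fin (n + 1))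
    (g : Fin (n + 1) → R) :
    ∏ j ∈ Finset.univ.erase k, g j = ∏ i, g (k.succAbove i) := by
  have h : Finset.univ.erase k = Finset.univ.image k.succAbove := by
    rw [Fin.image_succAbove_univ]
    ext
    simp
  rw [h, Finset.prod_image fun i _ j _ hij => Fin.succAbove_right_injective hij]

theorem orthantProb_sign_mul {l₀ : ℝ} {l e : Fin (n + 1) → ℝ} {k : Fin (n + 1)}
    (h₀ : 0 < l₀) (hl : ∀ i, 0 < l (k.succAbove i)) (hk : l k < 0) (hs : l₀ + ∑ j, l j < 0)
    {s : ℝ} (hsign : s = 1 ∨ s = -1) :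
    orthantProb l₀ l (fun j => s * e j) = orthantProb l₀ l e := by
  rcases hsign with rfl | rfl
  · simp
  · have hlne (j : Fin (n + 1)) : l j ≠ 0 := by
      rcases Fin.eq_self_or_eq_succAbove k j with rfl | ⟨i, rfl⟩
      · exact hk.ne
      · exact (hl i).ne'
    simpa using orthantProb_neg (orthantCov_posDef_of_neg_entry h₀ hl hk hs) h₀.ne' hlne hs.ne e

end NegativeEntry

/-! ### Both formulas -/

theorem theorem1p2 :
    -- (i)
    (∀ (d : ℕ) (l₀ : ℝ) (l e : Fin d → ℝ),
      (∀ j, 0 < l j) →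
      (0 < l₀ ∨ l₀ < -∑ j, l j) →
      (∀ j, e j = 1 ∨ e j = -1) →
      Integrable (fun x : ℝ =>
        (∏ j, complexPhi ((e j : ℂ) * (complexSqrt (l j) / complexSqrt l₀) * (x : ℂ))) *
          Complex.exp (-(x : ℂ) ^ 2 / 2)) ∧
      (orthantProb l₀ l e : ℂ) =
        1 / (Real.sqrt (2 * Real.pi) : ℂ) *
          ∫ x : ℝ,
            (∏ j, complexPhi ((e j : ℂ) * (complexSqrt (l j) / complexSqrt l₀) * (x : ℂ))) *
              Complex.exp (-(x : ℂ) ^ 2 / 2)) ∧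
    -- (ii)
    (∀ (d : ℕ) (k : Fin d) (l₀ : ℝ) (l e : Fin d → ℝ),
      0 < l₀ →
      (∀ j, j ≠ k → 0 < l j) →
      l k < 0 →
      l₀ + ∑ j, l j < 0 →
      (∀ j, e j = 1 ∨ e j = -1) →
      IntegrableOn (fun y : ℝ =>
        Complex.exp (-((l₀ : ℂ) * (y : ℂ) ^ 2 / 2)) *
          ∏ j ∈ Finset.univ.erase k,
            complexPhi ((e k : ℂ) * (e j : ℂ) * (Real.sqrt (l j) : ℂ) * (y : ℂ)))
        (Set.Ioi 0) ∧
      IntegrableOn (fun y : ℝ =>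
        Complex.exp ((l₀ : ℂ) * (y : ℂ) ^ 2 / 2) *
          complexPhi (-(Real.sqrt (-l k) : ℂ) * (y : ℂ)) *
          ((∏ j ∈ Finset.univ.erase k,
            complexPhi (Complex.I * (e k : ℂ) * (e j : ℂ) *
              (Real.sqrt (l j) : ℂ) * (y : ℂ))).im : ℂ))
        (Set.Ioi 0) ∧
      (orthantProb l₀ l e : ℂ) =
        (Real.sqrt (l₀ / (2 * Real.pi)) : ℂ) *
          ((∫ y in Set.Ioi (0 : ℝ),
              Complex.exp (-((l₀ : ℂ) * (y : ℂ) ^ 2 / 2)) *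
                ∏ j ∈ Finset.univ.erase k,
                  complexPhi ((e k : ℂ) * (e j : ℂ) * (Real.sqrt (l j) : ℂ) * (y : ℂ))) +
            2 * ∫ y in Set.Ioi (0 : ℝ),
              Complex.exp ((l₀ : ℂ) * (y : ℂ) ^ 2 / 2) *
                complexPhi (-(Real.sqrt (-l k) : ℂ) * (y : ℂ)) *
                ((∏ j ∈ Finset.univ.erase k,
                  complexPhi (Complex.I * (e k : ℂ) * (e j : ℂ) *
                    (Real.sqrt (l j) : ℂ) * (y : ℂ))).im : ℂ))) := by
  refine ⟨fun d l₀ l e hl h₀ he =>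
    integrable_and_orthantProb_eq_integral_prod_complexPhi hl h₀ he,
    fun d k l₀ l e h₀ hl hk hs he => ?_⟩
  obtain _ | n := d
  · exact k.elim0
  have hl' (i : Fin n) : 0 < l (k.succAbove i) := hl _ (Fin.succAbove_ne k i)
  have hekk : e k * e k = 1 := by
    rcases he k with h | h <;> simp [h]
  have he' (j : Fin (n + 1)) : e k * e j = 1 ∨ e k * e j = -1 := by
    rcases he k with h | h <;> rcases he j with h' | h' <;> simp [h, h']
  -- All signs are multiplied by `e k`: the `k`-th becomes `1`, and the probability is unchanged by
  -- the symmetry `η ↦ -η`.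
  have main := integrableOn_and_orthantProb_eq_of_neg_entry (e := fun j => e k * e j)
    h₀ hl' hk hs he' hekk
  rw [orthantProb_sign_mul h₀ hl' hk hs (he k)] at main
  have h1 (y : ℝ) : gaussianPhiProd l₀ (fun i => l (k.succAbove i))
      (fun i => e k * e (k.succAbove i)) y =
      Complex.exp (-((l₀ : ℂ) * (y : ℂ) ^ 2 / 2)) *
          ∏ j ∈ Finset.univ.erase k,
            complexPhi ((e k : ℂ) * (e j : ℂ) * (Real.sqrt (l j) : ℂ) * (y : ℂ)) := by
    rw [gaussianPhiProd, prod_univ_erase_eq_prod_succAbove, neg_div]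
    push_cast
    rfl
  have h2 (y : ℝ) : complexPhi (-(Real.sqrt (-l k) : ℂ) * (y : ℂ)) *
      ((gaussianPhiProd l₀ (fun i => l (k.succAbove i))
        (fun i => e k * e (k.succAbove i)) (y * Complex.I)).im : ℂ) =
      Complex.exp ((l₀ : ℂ) * (y : ℂ) ^ 2 / 2) *
          complexPhi (-(Real.sqrt (-l k) : ℂ) * (y : ℂ)) *
          ((∏ j ∈ Finset.univ.erase k,
            complexPhi (Complex.I * (e k : ℂ) * (e j : ℂ) *
              (Real.sqrt (l j) : ℂ) * (y : ℂ))).im : ℂ) := by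
    have hexp : Complex.exp (-(l₀ * (y * Complex.I) ^ 2) / 2) =
        ((Real.exp (l₀ * y ^ 2 / 2) : ℝ) : ℂ) := by
      push_cast
      rw [mul_pow, Complex.I_sq]
      congr 1
      ring
    have hprod : ∏ i, complexPhi (((e k * e (k.succAbove i) : ℝ) : ℂ) *
        (Real.sqrt (l (k.succAbove i)) : ℂ) * (y * Complex.I)) =
        ∏ j ∈ Finset.univ.erase k, complexPhi (Complex.I * (e k : ℂ) * (e j : ℂ) *
              (Real.sqrt (l j) : ℂ) * (y : ℂ)) := by
      rw [prod_univ_erase_eq_prod_succAbove]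
      refine Finset.prod_congr rfl fun i _ => ?_
      congr 1
      push_cast
      ring
    rw [gaussianPhiProd, hexp, hprod, Complex.im_ofReal_mul]
    push_cast
    ring
  simp only [h1, h2] at main
  exact main
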